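/- **Setting.** Let $\mathbb X$ be a finite nonempty set, let $f=(f(x))_{x\in\mathbb X}$ be a real-valued Gaussian process with arbitrary mean and covariance functions (the true function is drawn from the prior), and let $\sigma^2:\mathbb X\to[0,\infty)$ be a known noise variance. A measurement at $x_k$ yields $y_k=f(x_k)+v_k(x_k)$, where $v_k(x)\sim\mathcal N(0,\sigma^2(x))$ and the $v_k=(v_k(x))_x$ are independent over $k$. For a finite data set $D\subset\mathbb X\times\mathbb R$ let $\mu_D$, $K_D$ be the Gaussian process posterior mean and covariance functions, obtained from the prior ones by successive updates, for each $(x,y)\in D$, $$\mu\leftarrow \mu+\frac{K(\cdot,x)}{K(x,x)+\sigma^2(x)}(y-\mu(x)),\qquad K\leftarrow K-\frac{K(\cdot,x)K(x,\cdot)}{K(x,x)+\sigma^2(x)}$$ (no update if $K(x,x)+\sigma^2(x)=0$). With $D_x^{\varepsilon}:=D\cup\{(x,\;\mu_D(x)+\sqrt{K_D(x,x)+\sigma^2(x)}\,\varepsilon)\}$, the knowledge gradient and its approximation from base samples $\varepsilon^1,\dots,\varepsilon^N$ are $$\alpha_{\mathrm{KG}}(x;D)=\mathbb E_{\varepsilon\sim\mathcal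 N(0,1)}\Bigl[\max_{x'\in\mathbb X}\mu_{D_x^{\varepsilon}}(x')\Bigr]-\max_{\mathbb X}\mu_D,\qquad \hat\alpha_{\mathrm{KG},N}(x;D)=\frac1N\sum_{i=1}^N\max_{x'\in\mathbb X}\mu_{D_x^{\varepsilon^i}}(x')-\max_{\mathbb X}\mu_D .$$ Starting from initial data $\mathcal D_0$ (finitely many noisy measurements, at points chosen without looking ahead), the OKG policy in period $n=0,1,\dots$ chooses a number $N_n\ge1$ of fantasy samples depending on the past, draws fresh base samples that are i.i.d. $\mathcal N(0,1)$ and independent of $f$, of the noise and of the past, and measures at a point $x_{n+1}\in\arg\max_{x\in\mathbb X}\hat\alpha_{\mathrm{KG},N_n}(x;\mathcal D_n)$; ties may be broken by any rule that uses only the past, the current base samples and independent randomness. The new pair $(x_{n+1},y_{n+1})$ is added to $\mathcal D_n$ to give $\mathcal D_{n+1}$. Let $\chi_n\in\arg\max_{x\in\mathbb X}\mathbb E[f(x)\mid\mathcal D_n]$. **Theorem.** (1) There are measurable functions $A,K$ of the posterior mean and covariance functions such that for every finite data set $D$ the numbers $A_D:=A(\mu_D,K_D)$ and $K_D^{\circ}:=K(\mu_D,K_D)$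 are positive and finite and, for all $\delta>0$ and all integers $N\ge1$ with $N\ge A_D^{-1}\log(K_D^{\circ}/\delta)$, if $\varepsilon^1,\dots,\varepsilon^N$ are i.i.d. $\mathcal N(0,1)$ then $$\mathbb P\Bigl[\arg\max_{x}\hat\alpha_{\mathrm{KG},N}(x;D)\not\subseteq\arg\max_{x}\alpha_{\mathrm{KG}}(x;D)\Bigr]\le\delta .$$ (2) Let $A_n,K_n$ be any positive finite quantities that are functions of $\mathcal D_n$ (for instance those of (1) for $D=\mathcal D_n$). If for some $\delta>0$ the OKG policy uses sample sizes $N_n\ge1$ with $N_n\ge A_n^{-1}\log(K_n/\delta)$ almost surely for all $n$, then $$f(\chi_n)\longrightarrow\max_{x\in\mathbb X}f(x)\quad\text{almost surely.}$$ -/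

import Mathlib

open MeasureTheory ProbabilityTheory Filter Topology
open scoped NNReal

noncomputable section

namespace OKG

/-- The maximum of a real function on a finite nonempty set. -/
def maxVal {X : Type*} [Fintype X] [Nonempty X] (F : X → ℝ) : ℝ :=
  Finset.univ.sup' Finset.univ_nonempty F

/-- `x ∈ argmax F`. -/
def IsArgmax {X : Type*} (F : X → ℝ) (x : X) : Prop := ∀ z, F z ≤ F x

/-- A Gaussian law on `X → ℝ`, given by its mean function and its covariance function. -/
abbrev GPState (X : Type*) := (X → ℝ) × (X → X → ℝ)

/-- Gaussian process inference for one new observation `d = (x, y)`, where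
`y = f x + noise` and the noise is `N(0, σ² x)`. If the predictive variance `K x x + σ² x`
vanishes, then the observation carries no information; the convention `c / 0 = 0`
leaves the law unchanged in this case. -/
def update {X : Type*} (σ2 : X → ℝ≥0) (p : GPState X) (d : X × ℝ) : GPState X :=
  (fun z => p.1 z + p.2 z d.1 / (p.2 d.1 d.1 + σ2 d.1) * (d.2 - p.1 d.1),
   fun z z' => p.2 z z' - p.2 z d.1 * p.2 d.1 z' / (p.2 d.1 d.1 + σ2 d.1))

/-- The posterior mean and covariance functions given a finite data set,
by successive conditioning. -/
def posterior {X : Type*} (σ2 : X → ℝ≥0) (prior : GPState X) (D : List (X × ℝ)) : GPState X :=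
  D.foldl (update σ2) prior

/-- The reparametrized predictive sample `y_D(x) = μ_D(x) + √(K_D(x,x) + σ²(x)) ε`
of a noisy observation at `x`. -/
def fantasy {X : Type*} (σ2 : X → ℝ≥0) (p : GPState X) (x : X) (ε : ℝ) : ℝ :=
  p.1 x + Real.sqrt (p.2 x x + σ2 x) * ε

/-- The maximum of the posterior mean after the fantasy observation at `x`
which belongs to the base sample `ε` has been added to the data. -/
def nextMax {X : Type*} [Fintype X] [Nonempty X] (σ2 : X → ℝ≥0) (p : GPState X) (x : X)
    (ε : ℝ) : ℝ :=
  maxVal (update σ2 p (x, fantasy σ2 p x ε)).1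

/-- The knowledge gradient (one candidate point, identity objective). -/
def KG {X : Type*} [Fintype X] [Nonempty X] (σ2 : X → ℝ≥0) (p : GPState X) (x : X) : ℝ :=
  (∫ ε, nextMax σ2 p x ε ∂(gaussianReal 0 1)) - maxVal p.1

/-- The sample average approximation of the knowledge gradient with the `N` fixed
base samples `ε 0, …, ε (N - 1)`, common to all candidates. -/
def KGhat {X : Type*} [Fintype X] [Nonempty X] (σ2 : X → ℝ≥0) (p : GPState X) {N : ℕ}
    (ε : Fin N → ℝ) (x : X) : ℝ :=
  (1 / (N : ℝ)) * (∑ i, nextMax σ2 p x (ε i)) - maxVal p.1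

/-- The prior: mean and covariance functions of the process `f` under `P`. -/
def priorOf {Ω X : Type*} [MeasurableSpace Ω] (P : Measure Ω) (f : X → Ω → ℝ) : GPState X :=
  (fun x => ∫ ω, f x ω ∂P, fun x x' => cov[f x, f x'; P])

/-- The first `k` data points as a list. -/
def dataList {Ω X : Type*} (x : ℕ → Ω → X) (y : ℕ → Ω → ℝ) (k : ℕ) (ω : Ω) :
    List (X × ℝ) :=
  (List.range k).map fun j => (x j ω, y j ω)

/-- The σ-algebra generated by the first `k` data points (`X` is discrete). -/
@[reducible] def dataSigma {Ω X : Type*} (x : ℕ → Ω → X) (y : ℕ → Ω → ℝ) (k : ℕ) : MeasurableSpace Ω :=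
  ⨆ j : Fin k, MeasurableSpace.comap (x j) ⊤ ⊔ MeasurableSpace.comap (y j) inferInstance

/-- The σ-algebra generated by the base samples of period `n`. -/
@[reducible] def sampleSigma {Ω : Type*} (E : ℕ → ℕ → Ω → ℝ) (n : ℕ) : MeasurableSpace Ω :=
  ⨆ i, MeasurableSpace.comap (E n i) inferInstance

/-- What is known after `m₀` initial data points and `n` periods of sampling, before the base
samples of period `n` are drawn: the randomization variable `U`, the first `m₀ + n` data points
and the base samples of the periods before `n`. -/
@[reducible] def pastSigma {Ω X S : Type*} [MeasurableSpace S] (U : Ω → S) (E : ℕ → ℕ → Ω → ℝ)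
    (x : ℕ → Ω → X) (y : ℕ → Ω → ℝ) (m₀ n : ℕ) : MeasurableSpace Ω :=
  MeasurableSpace.comap U inferInstance ⊔ dataSigma x y (m₀ + n) ⊔ ⨆ j : Fin n, sampleSigma E j

/-- The probabilistic model: the true function `f` is drawn from a Gaussian process (its prior is
its law), `v k x` is the noise of the `k`-th measurement if it is taken at `x`, `E n i` is the
`i`-th base sample of period `n`, and `U` is a source of additional randomness
(for instance for breaking ties). The four sources are independent. -/
structure IsModel {Ω X S : Type*} [MeasurableSpace Ω] [MeasurableSpace S] (P : Measure Ω)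
    (σ2 : X → ℝ≥0) (f : X → Ω → ℝ) (v : ℕ → X → Ω → ℝ) (E : ℕ → ℕ → Ω → ℝ) (U : Ω → S) :
    Prop where
  measurable_f : ∀ x, Measurable (f x)
  measurable_v : ∀ k x, Measurable (v k x)
  measurable_E : ∀ n i, Measurable (E n i)
  measurable_U : Measurable U
  gaussian_f : IsGaussianProcess f P
  law_v : ∀ k x, P.map (v k x) = gaussianReal 0 (σ2 x)
  indep_v : iIndepFun (fun k ω x => v k x ω) P
  law_E : ∀ n i, P.map (E n i) = gaussianReal 0 1
  indep_E : iIndepFun (fun (a : ℕ × ℕ) ω => E a.1 a.2 ω) P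
  indep_v_E : IndepFun (fun ω k x => v k x ω) (fun ω n i => E n i ω) P
  indep_f : IndepFun (fun ω x => f x ω) (fun ω => (fun k x => v k x ω, fun n i => E n i ω)) P
  indep_U : IndepFun U
    (fun ω => (fun x => f x ω, fun k x => v k x ω, fun n i => E n i ω)) P

/-- The measurements `(x k, y k)` consist of `m₀` initial ones, at points that are chosen without
looking ahead, followed by those of the policy which in period `n` uses the data-dependent number
`N n` of fantasy samples and measures at a maximizer of the sample average approximation
of the knowledge gradient. -/
structure IsOKGRun {Ω X S : Type*} [MeasurableSpace Ω] [MeasurableSpace S] [Fintype X]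
    [Nonempty X] (P : Measure Ω) (σ2 : X → ℝ≥0) (f : X → Ω → ℝ) (v : ℕ → X → Ω → ℝ)
    (E : ℕ → ℕ → Ω → ℝ) (U : Ω → S) (m₀ : ℕ) (N : ℕ → Ω → ℕ) (x : ℕ → Ω → X)
    (y : ℕ → Ω → ℝ) : Prop where
  observation : ∀ k ω, y k ω = f (x k ω) ω + v k (x k ω) ω
  initial : ∀ k < m₀,
    Measurable[MeasurableSpace.comap U inferInstance ⊔ dataSigma x y k, ⊤] (x k)
  sampleSize : ∀ n, Measurable[pastSigma U E x y m₀ n] (N n)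
  sampleSize_pos : ∀ n ω, 1 ≤ N n ω
  nonanticipating : ∀ n,
    Measurable[pastSigma U E x y m₀ n ⊔ sampleSigma E n, ⊤] (x (m₀ + n))
  maximizer : ∀ n, ∀ᵐ ω ∂P,
    IsArgmax (KGhat σ2 (posterior σ2 (priorOf P f) (dataList x y (m₀ + n) ω))
      (fun i : Fin (N n ω) => E n i ω)) (x (m₀ + n) ω)

end OKG

end

/-! A fantasy observation moves the posterior mean affinely in the base sample, so `nextMax` is an
upper envelope of finitely many lines with slopes `slope`: convex and Lipschitz in the base sample.

Part (1) is a large deviation bound. A maximizer of the sample average that does not maximize `KG`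
must do at least as well, on the samples, as a fixed true maximizer, although its mean is lower by
at least `gapKG`. The difference of two envelopes is a Lipschitz function of a normal variable,
hence sub-Gaussian by symmetrization. Chernoff and a union bound give `Fintype.card X * exp (-N *
rateKG)`.

Part (2) is an exhaustion argument. Base samples are fresh, so for each fixed candidate the sample
average has the same mean as `KG`. It is at most the sample average at the measured point, which is
controlled by the slopes there, and the squares of these slopes are exactly the drops of the
posterior variances (`IsModel.state_cov_succ`). Mean variances decrease and are nonnegative, so
their drops vanish and the mean of `KG` tends to zero at every candidate. Pathwise, covariances
converge because slopes are square summable, and means converge by Lévy's upward theorem. With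
Fatou, the limiting `KG` is zero, which forces the limiting covariances `L z x'` to be independent
of `z` (`slope_eq_of_meanMax_eq`, `cov_eq_of_tendsto_KG`). Hence the posterior variance of every
difference `f z - f z'` vanishes: the limiting means determine `f` up to an additive random
constant, and that suffices for the maximizers.

What links the recursion to probability is a statement about fixed designs: the error of the
posterior mean is a regression residual, jointly Gaussian with and uncorrelated to the observations,
hence independent of them. An adaptive run agrees with one of finitely many fixed designs on each
event `visited`, and there its past is contained in the information of that design
(`IsAdapted.measurableSet_visited_and_inter`). -/

namespace OKG

/-! ### Maxima over a finite set -/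

section MaxVal

variable {X : Type*} [Fintype X] [Nonempty X]

theorem le_maxVal (F : X → ℝ) (z : X) : F z ≤ maxVal F :=
  Finset.le_sup' F (Finset.mem_univ z)

theorem maxVal_le {F : X → ℝ} {c : ℝ} (h : ∀ z, F z ≤ c) : maxVal F ≤ c :=
  Finset.sup'_le _ _ fun z _ => h z

theorem exists_eq_maxVal (F : X → ℝ) : ∃ z, F z = maxVal F := by
  obtain ⟨z, -, hz⟩ := Finset.exists_mem_eq_sup' (Finset.univ_nonempty (α := X)) F
  exact ⟨z, hz.symm⟩

theorem abs_maxVal_sub_maxVal_le {F G : X → ℝ} {c : ℝ} (h : ∀ z, |F z - G z| ≤ c) :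
    |maxVal F - maxVal G| ≤ c := by
  rw [abs_sub_le_iff]
  constructor
  · rw [sub_le_iff_le_add]
    exact maxVal_le fun z => by
      linarith [le_maxVal G z, (abs_sub_le_iff.1 (h z)).1]
  · rw [sub_le_iff_le_add]
    exact maxVal_le fun z => by
      linarith [le_maxVal F z, (abs_sub_le_iff.1 (h z)).2]

theorem measurable_maxVal : Measurable (maxVal : (X → ℝ) → ℝ) := by
  have : (maxVal : (X → ℝ) → ℝ) =
      Finset.univ.sup' Finset.univ_nonempty (fun z (F : X → ℝ) => F z) := by
    ext F; simp [maxVal, Finset.sup'_apply]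
  rw [this]
  exact Finset.measurable_sup' _ fun z _ => measurable_pi_apply z

end MaxVal

/-! ### Upper envelopes of affine functions under the normal law -/

section Affine

variable {X : Type*} [Fintype X]

theorem abs_le_sum_abs (s : X → ℝ) (z : X) : |s z| ≤ ∑ z, |s z| :=
  Finset.single_le_sum (f := fun z => |s z|) (fun _ _ => abs_nonneg _) (Finset.mem_univ z)

variable [Nonempty X]

/-- The upper envelope of finitely many affine functions. -/
noncomputable def lineMax (m s : X → ℝ) (ε : ℝ) : ℝ := maxVal fun z => m z + s z * ε

/-- The mean of an upper envelope of affine functions under the standard normal law. -/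
noncomputable def meanMax (m s : X → ℝ) : ℝ := ∫ ε, lineMax m s ε ∂(gaussianReal 0 1)

theorem lineMax_zero (m s : X → ℝ) : lineMax m s 0 = maxVal m := by simp [lineMax]

theorem abs_lineMax_sub_le (m s : X → ℝ) (a b : ℝ) :
    |lineMax m s a - lineMax m s b| ≤ (∑ z, |s z|) * |a - b| := by
  refine abs_maxVal_sub_maxVal_le fun z => ?_
  rw [add_sub_add_left_eq_sub, ← mul_sub, abs_mul]
  exact mul_le_mul_of_nonneg_right (abs_le_sum_abs s z) (abs_nonneg _)

theorem abs_lineMax_sub_maxVal_le (m s : X → ℝ) (a : ℝ) :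
    |lineMax m s a - maxVal m| ≤ (∑ z, |s z|) * |a| := by
  simpa [lineMax_zero] using abs_lineMax_sub_le m s a 0

theorem abs_lineMax_sub_lineMax_le (m s m' s' : X → ℝ) (a : ℝ) :
    |lineMax m s a - lineMax m' s' a| ≤ (∑ z, |m z - m' z|) + (∑ z, |s z - s' z|) * |a| := by
  refine abs_maxVal_sub_maxVal_le fun z => ?_
  have h1 := abs_le_sum_abs (fun z => m z - m' z) z
  have h2 := mul_le_mul_of_nonneg_right (abs_le_sum_abs (fun z => s z - s' z) z) (abs_nonneg a)
  calc |m z + s z * a - (m' z + s' z * a)| = |(m z - m' z) + (s z - s' z) * a| := by ring_nf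
    _ ≤ |m z - m' z| + |s z - s' z| * |a| := by rw [← abs_mul]; exact abs_add_le _ _
    _ ≤ _ := add_le_add h1 h2

theorem measurable_lineMax_uncurry :
    Measurable fun q : ((X → ℝ) × (X → ℝ)) × ℝ => lineMax q.1.1 q.1.2 q.2 := by
  refine measurable_maxVal.comp (measurable_pi_lambda _ fun z => ?_)
  fun_prop

theorem continuous_lineMax (m s : X → ℝ) : Continuous (lineMax m s) := by
  refine (LipschitzWith.of_dist_le_mul (K := (∑ z, |s z|).toNNReal) fun a b => ?_).continuous
  rw [Real.dist_eq, Real.dist_eq, Real.coe_toNNReal _ (Finset.sum_nonneg fun _ _ => abs_nonneg _)]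
  exact abs_lineMax_sub_le m s a b

theorem integrable_id_gaussianReal : Integrable (fun ε : ℝ => ε) (gaussianReal 0 1) :=
  (memLp_id_gaussianReal 1).integrable le_rfl

theorem integrable_lineMax (m s : X → ℝ) : Integrable (lineMax m s) (gaussianReal 0 1) := by
  have h : Integrable (fun ε => lineMax m s ε - maxVal m) (gaussianReal 0 1) := by
    refine (integrable_id_gaussianReal.abs.const_mul (∑ z, |s z|)).mono'
      ((continuous_lineMax m s).sub continuous_const).aestronglyMeasurable ?_
    exact ae_of_all _ fun ε => abs_lineMax_sub_maxVal_le m s ε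
  exact (h.add (integrable_const (maxVal m))).congr (ae_of_all _ fun ε => by simp)

theorem measurable_meanMax :
    Measurable fun q : (X → ℝ) × (X → ℝ) => meanMax q.1 q.2 :=
  (measurable_lineMax_uncurry.stronglyMeasurable.integral_prod_right
    (ν := gaussianReal 0 1)).measurable

/-- Jensen's inequality for the envelope: it lies above each line, and the line of `z` has mean `m
z`. This makes `KG` nonnegative. -/
theorem maxVal_le_meanMax (m s : X → ℝ) : maxVal m ≤ meanMax m s := by
  refine maxVal_le fun z => ?_
  have h : ∫ ε, (m z + s z * ε) ∂(gaussianReal 0 1) = m z := by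
    rw [integral_add (integrable_const _) (integrable_id_gaussianReal.const_mul _),
      integral_const_mul, integral_id_gaussianReal]
    simp
  calc m z = _ := h.symm
    _ ≤ _ := integral_mono
      ((integrable_const _).add (integrable_id_gaussianReal.const_mul _))
      (integrable_lineMax m s) fun ε => le_maxVal (fun z => m z + s z * ε) z

theorem abs_meanMax_sub_maxVal_le (m s : X → ℝ) :
    |meanMax m s - maxVal m| ≤ (∑ z, |s z|) * ∫ ε, |ε| ∂(gaussianReal 0 1) := by
  have : meanMax m s - maxVal m = ∫ ε, (lineMax m s ε - maxVal m) ∂(gaussianReal 0 1) := by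
    rw [integral_sub (integrable_lineMax m s) (integrable_const _)]; simp [meanMax]
  rw [this, ← integral_const_mul, ← Real.norm_eq_abs]
  exact norm_integral_le_of_norm_le (integrable_id_gaussianReal.abs.const_mul _)
    (ae_of_all _ fun ε => abs_lineMax_sub_maxVal_le m s ε)

/-- Envelopes differ at `ε` by at most an affine function of `|ε|` whose coefficients are the
distances of intercepts and slopes. This continuity transports `KG` to the limiting state. -/
theorem tendsto_meanMax {m s : ℕ → X → ℝ} {m' s' : X → ℝ}
    (hm : ∀ z, Tendsto (fun n => m n z) atTop (𝓝 (m' z)))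
    (hs : ∀ z, Tendsto (fun n => s n z) atTop (𝓝 (s' z))) :
    Tendsto (fun n => meanMax (m n) (s n)) atTop (𝓝 (meanMax m' s')) := by
  rw [tendsto_iff_norm_sub_tendsto_zero]
  have hb : ∀ n, ‖meanMax (m n) (s n) - meanMax m' s'‖ ≤
      (∑ z, |m n z - m' z|) + (∑ z, |s n z - s' z|) * ∫ ε, |ε| ∂(gaussianReal 0 1) := by
    intro n
    have h1 : Integrable (fun ε : ℝ => (∑ z, |m n z - m' z|) + (∑ z, |s n z - s' z|) * |ε|)
        (gaussianReal 0 1) :=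
      (integrable_const _).add (integrable_id_gaussianReal.abs.const_mul _)
    have h2 : (∑ z, |m n z - m' z|) + (∑ z, |s n z - s' z|) * ∫ ε, |ε| ∂(gaussianReal 0 1) =
        ∫ ε, ((∑ z, |m n z - m' z|) + (∑ z, |s n z - s' z|) * |ε|) ∂(gaussianReal 0 1) := by
      rw [integral_add (integrable_const _) (integrable_id_gaussianReal.abs.const_mul _),
        integral_const_mul]
      simp
    rw [h2, meanMax, meanMax, ← integral_sub (integrable_lineMax _ _) (integrable_lineMax _ _)]
    exact norm_integral_le_of_norm_le h1
      (ae_of_all _ fun ε => abs_lineMax_sub_lineMax_le _ _ _ _ _)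
  have h0 : ∀ (u : ℕ → X → ℝ) (u' : X → ℝ), (∀ z, Tendsto (fun n => u n z) atTop (𝓝 (u' z))) →
      Tendsto (fun n => ∑ z, |u n z - u' z|) atTop (𝓝 0) := by
    intro u u' hu
    have : Tendsto (fun n => ∑ z, |u n z - u' z|) atTop (𝓝 (∑ z, |u' z - u' z|)) :=
      tendsto_finsetSum _ fun z _ => ((hu z).sub_const _).abs
    simpa using this
  refine squeeze_zero (fun n => norm_nonneg _) hb ?_
  simpa using (h0 m m' hm).add ((h0 s s' hs).mul_const (∫ ε, |ε| ∂(gaussianReal 0 1)))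

/-- Full support turns almost everywhere equality of continuous functions into equality. -/
instance : (gaussianReal 0 1).IsOpenPosMeasure :=
  (gaussianReal_absolutelyContinuous' 0 one_ne_zero).isOpenPosMeasure

/-- If randomizing along the slopes `s` does not increase the mean of the maximum, then all
slopes agree. -/
theorem slope_eq_of_meanMax_eq {m s : X → ℝ} (h : meanMax m s = maxVal m) (z z' : X) :
    s z = s z' := by
  obtain ⟨y, hy⟩ := exists_eq_maxVal m
  -- The envelope dominates the line of a maximizer `y` of `m`, and by hypothesis both have mean `m
  -- y`. So they agree almost everywhere, and by continuity everywhere.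
  have key : lineMax m s = fun ε => m y + s y * ε := by
    have hint : Integrable (fun ε : ℝ => m y + s y * ε) (gaussianReal 0 1) :=
      (integrable_const _).add (integrable_id_gaussianReal.const_mul _)
    have hae : (fun ε => lineMax m s ε - (m y + s y * ε)) =ᵐ[gaussianReal 0 1] 0 := by
      have hnn : 0 ≤ fun ε => lineMax m s ε - (m y + s y * ε) := fun ε =>
        sub_nonneg.2 (le_maxVal (fun z => m z + s z * ε) y)
      rw [← integral_eq_zero_iff_of_nonneg hnn
        ((integrable_lineMax m s).sub hint), integral_sub (integrable_lineMax m s) hint,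
        integral_add (integrable_const _) (integrable_id_gaussianReal.const_mul _),
        integral_const_mul, integral_id_gaussianReal]
      change meanMax m s - _ = 0
      simp [h, hy]
    have hc : (fun ε => lineMax m s ε - (m y + s y * ε)) = fun _ => 0 :=
      Continuous.ae_eq_iff_eq (gaussianReal 0 1)
        ((continuous_lineMax m s).sub (by fun_prop)) continuous_const |>.1 hae
    ext ε
    linarith [congrFun hc ε]
  have hz : ∀ z, s z = s y := by
    intro z
    have hle : ∀ ε, m z + s z * ε ≤ m y + s y * ε := fun ε => by
      rw [← congrFun key ε]; exact le_maxVal (fun z => m z + s z * ε) z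
    by_contra hne
    have hne' : s z - s y ≠ 0 := sub_ne_zero.2 hne
    -- At this point the line of `z` would exceed that of `y` by exactly one.
    have h1 := hle ((m y - m z + 1) / (s z - s y))
    have h2 : (s z - s y) * ((m y - m z + 1) / (s z - s y)) = m y - m z + 1 := by
      field_simp
    linarith
  rw [hz z, hz z']

end Affine

/-! ### The knowledge gradient as the mean of an envelope -/

section KnowledgeGradient

variable {X : Type*} (σ2 : X → ℝ≥0)

/-- The standard deviation, with sign, of the change of the posterior mean at `z` that an
observation at `x` brings about. -/
noncomputable def slope (p : GPState X) (x z : X) : ℝ :=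
  p.2 z x / (p.2 x x + σ2 x) * Real.sqrt (p.2 x x + σ2 x)

theorem slope_sq {p : GPState X} {x : X} (h : 0 ≤ p.2 x x + σ2 x) (z : X) :
    slope σ2 p x z ^ 2 = p.2 z x ^ 2 / (p.2 x x + σ2 x) := by
  rw [slope, mul_pow, Real.sq_sqrt h]
  rcases eq_or_ne (p.2 x x + σ2 x) 0 with h0 | h0
  · simp [h0]
  · field_simp

theorem measurable_slope (x z : X) : Measurable fun p : GPState X => slope σ2 p x z := by
  unfold slope; fun_prop

theorem measurable_mean_slope (x : X) :
    Measurable fun p : GPState X => (p.1, slope σ2 p x) :=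
  measurable_fst.prodMk (measurable_pi_lambda _ fun z => measurable_slope σ2 x z)

variable [Fintype X] [Nonempty X]

theorem nextMax_eq_lineMax (p : GPState X) (x : X) (ε : ℝ) :
    nextMax σ2 p x ε = lineMax p.1 (slope σ2 p x) ε := by
  simp only [nextMax, update, fantasy, lineMax, slope]
  congr 1; ext z; ring

theorem KG_eq (p : GPState X) (x : X) :
    KG σ2 p x = meanMax p.1 (slope σ2 p x) - maxVal p.1 := by
  simp only [KG, nextMax_eq_lineMax, meanMax]

theorem KG_nonneg (p : GPState X) (x : X) : 0 ≤ KG σ2 p x := by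
  rw [KG_eq]; exact sub_nonneg.2 (maxVal_le_meanMax _ _)

theorem measurable_KG (x : X) : Measurable fun p : GPState X => KG σ2 p x := by
  simp only [KG_eq]
  exact (measurable_meanMax.comp (measurable_mean_slope σ2 x)).sub
    (measurable_maxVal.comp measurable_fst)

theorem measurable_nextMax (x : X) :
    Measurable fun q : GPState X × ℝ => nextMax σ2 q.1 x q.2 := by
  simp only [nextMax_eq_lineMax]
  exact measurable_lineMax_uncurry.comp
    (((measurable_mean_slope σ2 x).comp measurable_fst).prodMk measurable_snd)

end KnowledgeGradient

/-! ### Gaussian concentration for Lipschitz functions -/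

section Concentration

/-- Symmetrization with an independent copy. The exponential of the difference is replaced by
`cosh`, which has the same mean but is monotone in the absolute value of its argument, so that a
Lipschitz bound can be inserted. -/
theorem integral_cosh_sub_prod {μ : Measure ℝ} [IsProbabilityMeasure μ] {h : ℝ → ℝ}
    (h1 : Integrable (fun a => Real.exp (h a)) μ) (h2 : Integrable (fun a => Real.exp (-h a)) μ) :
    Integrable (fun q : ℝ × ℝ => Real.cosh (h q.1 - h q.2)) (μ.prod μ) ∧
      ∫ q, Real.cosh (h q.1 - h q.2) ∂(μ.prod μ) =
        (∫ a, Real.exp (h a) ∂μ) * ∫ a, Real.exp (-h a) ∂μ := by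
  have e : (fun q : ℝ × ℝ => Real.cosh (h q.1 - h q.2)) = fun q =>
      (1 / 2 : ℝ) * (Real.exp (h q.1) * Real.exp (-h q.2) +
        Real.exp (-h q.1) * Real.exp (h q.2)) := by
    ext q
    rw [Real.cosh_eq, ← Real.exp_add, ← Real.exp_add]
    ring_nf
  have i1 : Integrable (fun q : ℝ × ℝ => Real.exp (h q.1) * Real.exp (-h q.2)) (μ.prod μ) :=
    h1.mul_prod h2
  have i2 : Integrable (fun q : ℝ × ℝ => Real.exp (-h q.1) * Real.exp (h q.2)) (μ.prod μ) :=
    h2.mul_prod h1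
  rw [e]
  refine ⟨(i1.add i2).const_mul _, ?_⟩
  rw [integral_const_mul, integral_add i1 i2,
    integral_prod_mul (fun a => Real.exp (h a)) (fun a => Real.exp (-h a)),
    integral_prod_mul (fun a => Real.exp (-h a)) (fun a => Real.exp (h a))]
  ring

theorem integrable_exp_of_lipschitz {g : ℝ → ℝ} {l : ℝ} (hl : 0 ≤ l)
    (hg : ∀ a b, |g a - g b| ≤ l * |a - b|) :
    Integrable (fun a => Real.exp (g a)) (gaussianReal 0 1) := by
  have hc : Continuous g := (LipschitzWith.of_dist_le_mul (K := l.toNNReal) fun a b => by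
    rw [Real.dist_eq, Real.dist_eq, Real.coe_toNNReal _ hl]; exact hg a b).continuous
  have hi : Integrable (fun a : ℝ => Real.exp (l * |a|)) (gaussianReal 0 1) :=
    integrable_exp_mul_abs (integrable_exp_mul_gaussianReal l)
      (integrable_exp_mul_gaussianReal (-l))
  refine (hi.const_mul (Real.exp (g 0))).mono' (by fun_prop) (ae_of_all _ fun a => ?_)
  rw [Real.norm_eq_abs, abs_of_pos (Real.exp_pos _), ← Real.exp_add]
  have := (abs_sub_le_iff.1 (hg a 0)).1
  rw [sub_zero] at this
  exact Real.exp_le_exp.2 (by linarith)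

/-- Lipschitz functions of a standard normal variable are sub-Gaussian. -/
theorem hasSubgaussianMGF_of_lipschitz {g : ℝ → ℝ} {l : ℝ} (hl : 0 ≤ l)
    (hg : ∀ a b, |g a - g b| ≤ l * |a - b|) (hgi : Integrable g (gaussianReal 0 1)) :
    HasSubgaussianMGF (fun a => g a - ∫ b, g b ∂(gaussianReal 0 1)) (2 * l.toNNReal ^ 2)
      (gaussianReal 0 1) := by
  have hlip : ∀ t a b, |t * g a - t * g b| ≤ (|t| * l) * |a - b| := fun t a b => by
    rw [← mul_sub, abs_mul, mul_assoc]
    exact mul_le_mul_of_nonneg_left (hg a b) (abs_nonneg t)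
  have hint : ∀ t, Integrable (fun a => Real.exp (t * g a)) (gaussianReal 0 1) := fun t =>
    integrable_exp_of_lipschitz (g := fun a => t * g a) (mul_nonneg (abs_nonneg t) hl) (hlip t)
  set m := ∫ b, g b ∂(gaussianReal 0 1) with hm
  have hexp : ∀ t, (fun a => Real.exp (t * (g a - m))) =
      fun a => Real.exp (t * g a) * Real.exp (-(t * m)) := fun t => by
    ext a; rw [← Real.exp_add]; ring_nf
  refine ⟨fun t => by rw [hexp]; exact (hint t).mul_const _, fun t => ?_⟩
  have hneg : Integrable (fun a => Real.exp (-(t * g a))) (gaussianReal 0 1) := by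
    simpa using hint (-t)
  -- Jensen replaces the centering factor by the exponential moment of an independent copy.
  have hjensen : Real.exp (-(t * m)) ≤ ∫ a, Real.exp (-(t * g a)) ∂(gaussianReal 0 1) := by
    have := convexOn_exp.map_integral_le (μ := gaussianReal 0 1) (f := fun a => -(t * g a))
      Real.continuous_exp.continuousOn isClosed_univ (by simp) (hgi.const_mul t).neg hneg
    rwa [integral_neg, integral_const_mul] at this
  obtain ⟨c1, c2⟩ := integral_cosh_sub_prod (h := fun a => t * g a) (hint t) hneg
  have e1 : Integrable (fun a : ℝ => Real.exp (t * l * a)) (gaussianReal 0 1) :=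
    integrable_exp_mul_gaussianReal (t * l)
  have e2 : Integrable (fun a : ℝ => Real.exp (-(t * l * a))) (gaussianReal 0 1) := by
    simpa using integrable_exp_mul_gaussianReal (μ := 0) (v := 1) (-(t * l))
  obtain ⟨d1, d2⟩ := integral_cosh_sub_prod (h := fun a => t * l * a) e1 e2
  -- Comparison with the linear function `l * a`, whose exponential moments are explicit.
  have hle : ∫ q, Real.cosh (t * g q.1 - t * g q.2) ∂((gaussianReal 0 1).prod (gaussianReal 0 1)) ≤
      ∫ q, Real.cosh (t * l * q.1 - t * l * q.2)
        ∂((gaussianReal 0 1).prod (gaussianReal 0 1)) := by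
    refine integral_mono c1 d1 fun q => Real.cosh_le_cosh.2 ((hlip t _ _).trans_eq ?_)
    rw [← mul_sub, abs_mul, abs_mul, abs_of_nonneg hl]
  have hmgf : ∀ s : ℝ, ∫ a, Real.exp (s * a) ∂(gaussianReal 0 1) = Real.exp (s ^ 2 / 2) := by
    intro s
    have := congrFun (mgf_id_gaussianReal (μ := 0) (v := 1)) s
    simpa [mgf] using this
  calc mgf (fun a => g a - m) (gaussianReal 0 1) t
      = (∫ a, Real.exp (t * g a) ∂(gaussianReal 0 1)) * Real.exp (-(t * m)) := by
        rw [mgf, hexp, integral_mul_const]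
    _ ≤ (∫ a, Real.exp (t * g a) ∂(gaussianReal 0 1)) *
          ∫ a, Real.exp (-(t * g a)) ∂(gaussianReal 0 1) :=
        mul_le_mul_of_nonneg_left hjensen (integral_nonneg fun _ => (Real.exp_pos _).le)
    _ ≤ (∫ a, Real.exp (t * l * a) ∂(gaussianReal 0 1)) *
          ∫ a, Real.exp (-(t * l * a)) ∂(gaussianReal 0 1) := by rwa [← c2, ← d2]
    -- Both factors equal `exp (t ^ 2 * l ^ 2 / 2)`; the 2 in the variance proxy is the price of the
    -- independent copy.
    _ = Real.exp ((2 * l.toNNReal ^ 2 : ℝ≥0) * t ^ 2 / 2) := by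
        have h2 := hmgf (-(t * l))
        simp only [neg_mul] at h2
        rw [hmgf, h2, ← Real.exp_add]
        push_cast
        rw [Real.coe_toNNReal _ hl]
        ring_nf

/-- Chernoff bound for the empirical mean of a Lipschitz function of standard normal variables. -/
theorem measureReal_nonneg_sum_le {g : ℝ → ℝ} {l d : ℝ} (hl : 0 < l) (hd : 0 < d)
    (hg : ∀ a b, |g a - g b| ≤ l * |a - b|) (hgi : Integrable g (gaussianReal 0 1))
    (hmean : ∫ a, g a ∂(gaussianReal 0 1) ≤ -d) (N : ℕ) :
    (Measure.pi fun _ : Fin N => gaussianReal 0 1).real {ε | 0 ≤ ∑ i, g (ε i)} ≤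
      Real.exp (-(N * (d ^ 2 / (4 * l ^ 2)))) := by
  have hcont : Continuous g := (LipschitzWith.of_dist_le_mul (K := l.toNNReal) fun a b => by
    rw [Real.dist_eq, Real.dist_eq, Real.coe_toNNReal _ hl.le]; exact hg a b).continuous
  have hsub := hasSubgaussianMGF_of_lipschitz hl.le hg hgi
  set m := ∫ a, g a ∂(gaussianReal 0 1)
  have hmeas : Measurable fun a => g a - m := hcont.measurable.sub_const m
  have hind : iIndepFun (fun (i : Fin N) (ε : Fin N → ℝ) => g (ε i) - m)
      (Measure.pi fun _ : Fin N => gaussianReal 0 1) :=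
    iIndepFun_pi (X := fun (_ : Fin N) a => g a - m) fun _ => hmeas.aemeasurable
  have hsubi : ∀ i ∈ Finset.univ, HasSubgaussianMGF (fun ε : Fin N → ℝ => g (ε i) - m)
      (2 * l.toNNReal ^ 2) (Measure.pi fun _ : Fin N => gaussianReal 0 1) := by
    intro i _
    refine HasSubgaussianMGF.of_map (Y := fun ε : Fin N → ℝ => ε i) (X := fun a => g a - m)
      (measurable_pi_apply i).aemeasurable ?_
    rw [(measurePreserving_eval (fun _ : Fin N => gaussianReal 0 1) i).map_eq]
    exact hsub
  have hN : (0 : ℝ) ≤ N * d := mul_nonneg (Nat.cast_nonneg N) hd.le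
  -- A nonnegative sum exceeds its mean by at least `N * d`. With total variance proxy `2 * N * l ^
  -- 2` the exponent is `(N * d) ^ 2 / (4 * N * l ^ 2)`.
  have h := HasSubgaussianMGF.measure_sum_ge_le_of_iIndepFun hind hsubi hN
  refine (measureReal_mono (fun ε hε => ?_) (measure_ne_top _ _)).trans (h.trans_eq ?_)
  · simp only [Set.mem_ofPred_eq] at hε ⊢
    rw [Finset.sum_sub_distrib]
    simp only [Finset.sum_const, Finset.card_univ, Fintype.card_fin, nsmul_eq_mul]
    nlinarith [mul_le_mul_of_nonneg_left hmean (Nat.cast_nonneg (α := ℝ) N)]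
  · congr 1
    simp only [Finset.sum_const, Finset.card_univ, Fintype.card_fin, nsmul_eq_mul]
    push_cast
    rw [Real.coe_toNNReal _ hl.le]
    rcases Nat.eq_zero_or_pos N with rfl | hpos
    · simp
    · have : (N : ℝ) ≠ 0 := by positivity
      field_simp
      norm_num

end Concentration

/-! ### Identifying the maximizers of the knowledge gradient by sampling -/

section SampleAverage

variable {X : Type*} [Fintype X] [Nonempty X] (σ2 : X → ℝ≥0)

/-- The smallest positive difference between two values of the knowledge gradient
(at most one). -/
noncomputable def gapKG (p : GPState X) : ℝ :=
  Finset.univ.inf' Finset.univ_nonempty fun q : X × X =>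
    if KG σ2 p q.1 < KG σ2 p q.2 then KG σ2 p q.2 - KG σ2 p q.1 else 1

/-- A common Lipschitz constant of the functions `nextMax σ2 p x`. -/
noncomputable def lipKG (p : GPState X) : ℝ := 1 + ∑ x, ∑ z, |slope σ2 p x z|

/-- The rate at which sample average approximation identifies the maximizers of `KG`. -/
noncomputable def rateKG (p : GPState X) : ℝ := gapKG σ2 p ^ 2 / (4 * (2 * lipKG σ2 p) ^ 2)

theorem gapKG_pos (p : GPState X) : 0 < gapKG σ2 p := by
  rw [gapKG, Finset.lt_inf'_iff]
  intro q _
  split_ifs with h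
  · exact sub_pos.2 h
  · exact one_pos

theorem gapKG_le {p : GPState X} {x x' : X} (h : KG σ2 p x < KG σ2 p x') :
    gapKG σ2 p ≤ KG σ2 p x' - KG σ2 p x := by
  have := Finset.inf'_le (fun q : X × X =>
    if KG σ2 p q.1 < KG σ2 p q.2 then KG σ2 p q.2 - KG σ2 p q.1 else 1) (Finset.mem_univ (x, x'))
  rwa [if_pos h] at this

omit [Nonempty X] in
theorem lipKG_pos (p : GPState X) : 0 < lipKG σ2 p := by
  unfold lipKG; positivity

theorem rateKG_pos (p : GPState X) : 0 < rateKG σ2 p := by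
  have h1 := gapKG_pos σ2 p
  have h2 := lipKG_pos σ2 p
  unfold rateKG; positivity

theorem measurable_gapKG : Measurable (gapKG σ2) := by
  have : gapKG σ2 = Finset.univ.inf' Finset.univ_nonempty fun (q : X × X) (p : GPState X) =>
      if KG σ2 p q.1 < KG σ2 p q.2 then KG σ2 p q.2 - KG σ2 p q.1 else 1 := by
    ext p; simp [gapKG, Finset.inf'_apply]
  rw [this]
  refine Finset.inf'_induction _ _ (fun _ h1 _ h2 => h1.inf h2) fun q _ =>
    Measurable.ite ?_ ?_ measurable_const
  · exact measurableSet_lt (measurable_KG σ2 q.1) (measurable_KG σ2 q.2)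
  · exact (measurable_KG σ2 q.2).sub (measurable_KG σ2 q.1)

omit [Nonempty X] in
theorem measurable_lipKG : Measurable (lipKG σ2) := by
  refine measurable_const.add (Finset.measurable_fun_sum _ fun x _ =>
    Finset.measurable_fun_sum _ fun z _ => ?_)
  exact (measurable_slope σ2 x z).abs

theorem measurable_rateKG : Measurable (rateKG σ2) := by
  have h1 := measurable_gapKG σ2
  have h2 := measurable_lipKG σ2
  unfold rateKG
  fun_prop

theorem abs_nextMax_sub_le (p : GPState X) (x : X) (a b : ℝ) :
    |nextMax σ2 p x a - nextMax σ2 p x b| ≤ lipKG σ2 p * |a - b| := by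
  rw [nextMax_eq_lineMax, nextMax_eq_lineMax]
  refine (abs_lineMax_sub_le _ _ a b).trans (mul_le_mul_of_nonneg_right ?_ (abs_nonneg _))
  have := Finset.single_le_sum (f := fun x => ∑ z, |slope σ2 p x z|)
    (fun _ _ => Finset.sum_nonneg fun _ _ => abs_nonneg _) (Finset.mem_univ x)
  rw [lipKG]
  linarith

theorem integrable_nextMax (p : GPState X) (x : X) :
    Integrable (nextMax σ2 p x) (gaussianReal 0 1) := by
  have : nextMax σ2 p x = lineMax p.1 (slope σ2 p x) := by
    ext ε; exact nextMax_eq_lineMax σ2 p x ε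
  rw [this]
  exact integrable_lineMax _ _

/-- The probability that some maximizer of the sample average approximation does not maximize
the knowledge gradient decreases exponentially in the number of samples. -/
theorem measureReal_argmax_not_subset_le (p : GPState X) {N : ℕ} (hN : 1 ≤ N) :
    (Measure.pi fun _ : Fin N => gaussianReal 0 1).real
      {ε | ¬ ∀ z, IsArgmax (KGhat σ2 p ε) z → IsArgmax (KG σ2 p) z} ≤
      Fintype.card X * Real.exp (-(N * rateKG σ2 p)) := by
  classical
  obtain ⟨y, hy⟩ := exists_eq_maxVal (KG σ2 p)
  set bad : Finset X := Finset.univ.filter fun z => KG σ2 p z < KG σ2 p y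
  -- Comparing every bad candidate with one fixed true maximizer `y` keeps the union bound linear in
  -- the number of candidates.
  have hsub : {ε : Fin N → ℝ | ¬ ∀ z, IsArgmax (KGhat σ2 p ε) z → IsArgmax (KG σ2 p) z} ⊆
      ⋃ z ∈ bad, {ε | 0 ≤ ∑ i, (nextMax σ2 p z (ε i) - nextMax σ2 p y (ε i))} := by
    intro ε hε
    simp only [Set.mem_ofPred_eq, not_forall] at hε
    obtain ⟨z, hz, hz'⟩ := hε
    have hbad : z ∈ bad := by
      simp only [bad, Finset.mem_filter, Finset.mem_univ, true_and]
      by_contra hcon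
      exact hz' fun x => (le_maxVal (KG σ2 p) x).trans (hy ▸ not_lt.1 hcon)
    refine Set.mem_biUnion hbad ?_
    have h := hz y
    simp only [KGhat, sub_le_sub_iff_right] at h
    have hNpos : (0 : ℝ) < 1 / (N : ℝ) := by positivity
    have := le_of_mul_le_mul_left h hNpos
    rw [Set.mem_ofPred_eq, Finset.sum_sub_distrib]
    linarith
  have hone : ∀ z ∈ bad, (Measure.pi fun _ : Fin N => gaussianReal 0 1).real
      {ε | 0 ≤ ∑ i, (nextMax σ2 p z (ε i) - nextMax σ2 p y (ε i))} ≤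
      Real.exp (-(N * rateKG σ2 p)) := by
    intro z hz
    have hz' : KG σ2 p z < KG σ2 p y := by simpa [bad] using hz
    -- A difference of two functions with Lipschitz constant `lipKG` accounts for the factor two in
    -- `rateKG`.
    refine measureReal_nonneg_sum_le (g := fun a => nextMax σ2 p z a - nextMax σ2 p y a)
      (mul_pos two_pos (lipKG_pos σ2 p)) (gapKG_pos σ2 p) (fun a b => ?_)
      ((integrable_nextMax σ2 p z).sub (integrable_nextMax σ2 p y)) ?_ N
    · have h1 := abs_nextMax_sub_le σ2 p z a b
      have h2 := abs_nextMax_sub_le σ2 p y a b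
      calc _ = |(nextMax σ2 p z a - nextMax σ2 p z b) -
              (nextMax σ2 p y a - nextMax σ2 p y b)| := by ring_nf
        _ ≤ _ := (abs_sub _ _).trans (by linarith)
    · rw [integral_sub (integrable_nextMax σ2 p z) (integrable_nextMax σ2 p y)]
      have := gapKG_le σ2 hz'
      simp only [KG] at this
      linarith
  calc _ ≤ (Measure.pi fun _ : Fin N => gaussianReal 0 1).real
        (⋃ z ∈ bad, {ε | 0 ≤ ∑ i, (nextMax σ2 p z (ε i) - nextMax σ2 p y (ε i))}) :=
      measureReal_mono hsub (measure_ne_top _ _)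
    _ ≤ ∑ z ∈ bad, (Measure.pi fun _ : Fin N => gaussianReal 0 1).real
        {ε | 0 ≤ ∑ i, (nextMax σ2 p z (ε i) - nextMax σ2 p y (ε i))} :=
      measureReal_biUnion_finset_le _ _
    _ ≤ ∑ z ∈ bad, Real.exp (-(N * rateKG σ2 p)) := Finset.sum_le_sum hone
    _ ≤ _ := by
      rw [Finset.sum_const, nsmul_eq_mul]
      exact mul_le_mul_of_nonneg_right (Nat.cast_le.2 (Finset.card_le_univ _)) (Real.exp_pos _).le

theorem measureReal_argmax_not_subset_le_of_le (p : GPState X) {δ : ℝ} (hδ : 0 < δ) {N : ℕ}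
    (hN : 1 ≤ N) (h : (rateKG σ2 p)⁻¹ * Real.log (Fintype.card X / δ) ≤ N) :
    (Measure.pi fun _ : Fin N => gaussianReal 0 1).real
      {ε | ¬ ∀ z, IsArgmax (KGhat σ2 p ε) z → IsArgmax (KG σ2 p) z} ≤ δ := by
  have hr := rateKG_pos σ2 p
  have hc : (0 : ℝ) < Fintype.card X := by exact_mod_cast Fintype.card_pos
  have h1 : Real.log (Fintype.card X / δ) ≤ N * rateKG σ2 p := by
    rwa [inv_mul_le_iff₀ hr, mul_comm] at h
  refine (measureReal_argmax_not_subset_le σ2 p hN).trans ?_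
  have h2 := Real.exp_le_exp.2 h1
  rw [Real.exp_log (by positivity), div_le_iff₀ hδ] at h2
  rwa [Real.exp_neg, ← div_eq_mul_inv, div_le_iff₀ (Real.exp_pos _), mul_comm]

end SampleAverage

/-! ### Successive linear regression as orthogonal projection -/

section Residual

variable {X M : Type*} [AddCommGroup M] [Module ℝ M]

/-- Successive linear regression in a space with a bilinear form: `residual k z` is what is left of
`e z` after regression on the noisy observations `e (a j) + n j`, `j < k`. -/
noncomputable def residual (B : LinearMap.BilinForm ℝ M) (σ2 : X → ℝ≥0) (e : X → M) (n : ℕ → M)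
    (a : ℕ → X) : ℕ → X → M
  | 0 => e
  | k + 1 => fun z => residual B σ2 e n a k z -
      (B (residual B σ2 e n a k z) (residual B σ2 e n a k (a k)) /
        (B (residual B σ2 e n a k (a k)) (residual B σ2 e n a k (a k)) + σ2 (a k))) •
        (residual B σ2 e n a k (a k) + n k)

variable {B : LinearMap.BilinForm ℝ M} {σ2 : X → ℝ≥0} {e : X → M} {n : ℕ → M} {a : ℕ → X}

theorem residual_succ (k : ℕ) (z : X) :
    residual B σ2 e n a (k + 1) z = residual B σ2 e n a k z -
      (B (residual B σ2 e n a k z) (residual B σ2 e n a k (a k)) /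
        (B (residual B σ2 e n a k (a k)) (residual B σ2 e n a k (a k)) + σ2 (a k))) •
        (residual B σ2 e n a k (a k) + n k) := rfl

theorem residual_mem_span (k : ℕ) (z : X) :
    residual B σ2 e n a k z ∈ Submodule.span ℝ (Set.range (Sum.elim e n)) := by
  induction k generalizing z with
  | zero => exact Submodule.subset_span ⟨Sum.inl z, rfl⟩
  | succ k ih =>
    exact Submodule.sub_mem _ (ih z) (Submodule.smul_mem _ _
      (Submodule.add_mem _ (ih _) (Submodule.subset_span ⟨Sum.inr k, rfl⟩)))

theorem sub_residual_mem_span (k : ℕ) (z : X) :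
    e z - residual B σ2 e n a k z ∈
      Submodule.span ℝ ((fun j => e (a j) + n j) '' Set.Iio k) := by
  induction k generalizing z with
  | zero => simp [residual]
  | succ k ih =>
    have hmono : Submodule.span ℝ ((fun j => e (a j) + n j) '' Set.Iio k) ≤
        Submodule.span ℝ ((fun j => e (a j) + n j) '' Set.Iio (k + 1)) :=
      Submodule.span_mono (Set.image_mono (Set.Iio_subset_Iio (Nat.le_succ k)))
    have hk : e (a k) + n k ∈ Submodule.span ℝ ((fun j => e (a j) + n j) '' Set.Iio (k + 1)) :=
      Submodule.subset_span ⟨k, Nat.lt_succ_self k, rfl⟩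
    have h1 : residual B σ2 e n a k (a k) + n k ∈
        Submodule.span ℝ ((fun j => e (a j) + n j) '' Set.Iio (k + 1)) := by
      have := Submodule.sub_mem _ hk (hmono (ih (a k)))
      convert this using 1
      abel
    simp only [residual]
    rw [sub_sub_eq_add_sub, add_sub_right_comm]
    exact Submodule.add_mem _ (hmono (ih z)) (Submodule.smul_mem _ _ h1)

/-- Only the noises before step `k` have entered the residual `k`. -/
theorem bilin_residual_noise (hne : ∀ j x, B (e x) (n j) = 0)
    (hnn : ∀ i j, i ≠ j → B (n i) (n j) = 0) (k : ℕ) (z : X) {j : ℕ} (hj : k ≤ j) :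
    B (residual B σ2 e n a k z) (n j) = 0 := by
  induction k generalizing z with
  | zero => exact hne j z
  | succ k ih =>
    simp [residual, ih _ (Nat.le_of_succ_le hj), hnn k j (Nat.ne_of_lt hj)]

theorem bilin_sq_le (hs : ∀ u w, B u w = B w u) (hp : ∀ u, 0 ≤ B u u) (u w : M) :
    B u w ^ 2 ≤ B u u * B w w := by
  have key : ∀ t : ℝ, 0 ≤ B u u * (t * t) + (2 * B u w) * t + B w w := fun t => by
    have := hp (t • u + w)
    simp only [map_add, map_smul, LinearMap.add_apply, LinearMap.smul_apply, smul_eq_mul,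
      hs w u] at this
    linarith
  have := discrim_le_zero key
  rw [discrim] at this
  nlinarith

variable (hs : ∀ u w, B u w = B w u) (hp : ∀ u, 0 ≤ B u u) (hne : ∀ j x, B (e x) (n j) = 0)
  (hnn : ∀ i j, i ≠ j → B (n i) (n j) = 0) (hvar : ∀ j, B (n j) (n j) = σ2 (a j))

include hs hne hnn hvar in
-- The cross terms vanish, so the denominator of the update is the squared length of the innovation
-- and the regression coefficient is that of an orthogonal projection.
theorem bilin_innovation (k : ℕ) :
    B (residual B σ2 e n a k (a k) + n k) (residual B σ2 e n a k (a k) + n k) =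
      B (residual B σ2 e n a k (a k)) (residual B σ2 e n a k (a k)) + σ2 (a k) := by
  have h := bilin_residual_noise (σ2 := σ2) (a := a) hne hnn k (a k) le_rfl
  simp [h, hs (n k), hvar k]

include hs hp hne hnn hvar in
theorem bilin_residual_innovation (k : ℕ) (z : X) :
    B (residual B σ2 e n a (k + 1) z) (residual B σ2 e n a k (a k) + n k) = 0 := by
  have h := bilin_residual_noise (σ2 := σ2) (a := a) hne hnn k z le_rfl
  rw [residual, map_sub, LinearMap.sub_apply, map_smul, LinearMap.smul_apply,
    bilin_innovation hs hne hnn hvar k, map_add, h, add_zero, smul_eq_mul]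
  set r := residual B σ2 e n a k
  -- In the degenerate case the coefficient is zero by `c / 0 = 0`; nothing needs removing, since by
  -- Cauchy–Schwarz the covariance already vanishes.
  rcases eq_or_ne (B (r (a k)) (r (a k)) + σ2 (a k)) 0 with h0 | h0
  · have hz : B (r (a k)) (r (a k)) = 0 :=
      le_antisymm (by linarith [(σ2 (a k)).coe_nonneg]) (hp _)
    have := bilin_sq_le hs hp (r z) (r (a k))
    rw [hz, mul_zero] at this
    rw [h0, mul_zero, sub_zero]
    exact pow_eq_zero_iff two_ne_zero |>.1 (le_antisymm this (sq_nonneg _))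
  · rw [div_mul_cancel₀ _ h0, sub_self]

include hs hp hne hnn hvar in
-- Gram–Schmidt: a step makes the residual orthogonal to the new innovation, and keeps the earlier
-- orthogonality because the innovation is itself orthogonal to the earlier observations.
theorem bilin_residual_span (k : ℕ) (z : X) {w : M}
    (hw : w ∈ Submodule.span ℝ ((fun j => e (a j) + n j) '' Set.Iio k)) :
    B (residual B σ2 e n a k z) w = 0 := by
  have key : ∀ k z, ∀ j < k, B (residual B σ2 e n a k z) (e (a j) + n j) = 0 := by
    intro k
    induction k with
    | zero => intro z j hj; exact absurd hj (Nat.not_lt_zero j)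
    | succ k ih =>
      have span_zero : ∀ z, ∀ w ∈ Submodule.span ℝ ((fun j => e (a j) + n j) '' Set.Iio k),
          B (residual B σ2 e n a k z) w = 0 := by
        intro z w hw
        refine Submodule.span_induction ?_ (map_zero _) ?_ ?_ hw
        · rintro _ ⟨j, hj, rfl⟩; exact ih z j hj
        · intro x y _ _ hx hy; rw [map_add, hx, hy, add_zero]
        · intro c x _ hx; rw [map_smul, hx, smul_zero]
      have noise_zero : ∀ w ∈ Submodule.span ℝ ((fun j => e (a j) + n j) '' Set.Iio k),
          B (n k) w = 0 := by
        intro w hw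
        refine Submodule.span_induction ?_ (map_zero _) ?_ ?_ hw
        · rintro _ ⟨j, hj, rfl⟩
          rw [map_add, hs, hne, hnn k j (Nat.ne_of_gt hj), add_zero]
        · intro x y _ _ hx hy; rw [map_add, hx, hy, add_zero]
        · intro c x _ hx; rw [map_smul, hx, smul_zero]
      have step_zero : ∀ z, ∀ w ∈ Submodule.span ℝ ((fun j => e (a j) + n j) '' Set.Iio k),
          B (residual B σ2 e n a (k + 1) z) w = 0 := by
        intro z w hw
        simp only [residual, map_sub, map_smul, map_add, LinearMap.sub_apply,
          LinearMap.smul_apply, LinearMap.add_apply, span_zero _ w hw, noise_zero w hw]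
        simp
      intro z j hj
      rcases Nat.lt_succ_iff_lt_or_eq.1 hj with hj | rfl
      · exact step_zero z _ (Submodule.subset_span ⟨j, hj, rfl⟩)
      -- The newest observation is its innovation plus a combination of earlier observations.
      · have : e (a j) + n j = (residual B σ2 e n a j (a j) + n j) +
            (e (a j) - residual B σ2 e n a j (a j)) := by abel
        rw [this, map_add, bilin_residual_innovation hs hp hne hnn hvar,
          step_zero z _ (sub_residual_mem_span j (a j)), add_zero]
  refine Submodule.span_induction ?_ (map_zero _) ?_ ?_ hw
  · rintro _ ⟨j, hj, rfl⟩; exact key k z j hj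
  · intro x y _ _ hx hy; rw [map_add, hx, hy, add_zero]
  · intro c x _ hx; rw [map_smul, hx, smul_zero]

include hs hp hne hnn hvar in
-- This reproduces the covariance recursion of `update`. Since the new residual is orthogonal to the
-- innovation, only one of the two factors has to be expanded.
theorem bilin_residual_succ (k : ℕ) (z z' : X) :
    B (residual B σ2 e n a (k + 1) z) (residual B σ2 e n a (k + 1) z') =
      B (residual B σ2 e n a k z) (residual B σ2 e n a k z') -
        B (residual B σ2 e n a k z) (residual B σ2 e n a k (a k)) *
          B (residual B σ2 e n a k (a k)) (residual B σ2 e n a k z') /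
          (B (residual B σ2 e n a k (a k)) (residual B σ2 e n a k (a k)) + σ2 (a k)) := by
  have h := bilin_residual_innovation hs hp hne hnn hvar k z
  have hz' := bilin_residual_noise (σ2 := σ2) (a := a) hne hnn k z' le_rfl
  rw [residual_succ k z', map_sub, map_smul, h, smul_zero, sub_zero, residual_succ k z]
  simp only [map_sub, map_smul, map_add, LinearMap.sub_apply, LinearMap.smul_apply,
    LinearMap.add_apply, smul_eq_mul, hs (n k), hz', add_zero]
  ring

end Residual

/-! ### Gaussian processes built from linear combinations and independent parts -/

section GaussianSpan

variable {Ω S T : Type*} [MeasurableSpace Ω] {P : Measure Ω}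

theorem isGaussianProcess_of_mem_span {Z : T → Ω → ℝ} {Y : S → Ω → ℝ}
    (hZ : IsGaussianProcess Z P) (h : ∀ s, Y s ∈ Submodule.span ℝ (Set.range Z)) :
    IsGaussianProcess Y P := by
  refine hZ.of_isGaussianProcess fun s => ?_
  obtain ⟨c, hc⟩ := Finsupp.mem_span_range_iff_exists_finsupp.1 (h s)
  refine ⟨c.support, ∑ i : c.support, c i • ContinuousLinearMap.proj i, fun ω => ?_⟩
  rw [← hc, Finsupp.sum, Finset.sum_apply, ← Finset.sum_coe_sort]
  simp

theorem hasGaussianLaw_sub_const {E : Type*} [NormedAddCommGroup E] [NormedSpace ℝ E]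
    [MeasurableSpace E] [BorelSpace E] {Z : Ω → E} (hZ : HasGaussianLaw Z P) (c : E) :
    HasGaussianLaw (fun ω => Z ω - c) P := by
  constructor
  have := hZ.isGaussian_map
  have e : P.map (fun ω => Z ω - c) = (P.map Z).map (fun x => x - c) := by
    rw [AEMeasurable.map_map_of_aemeasurable (by fun_prop) hZ.aemeasurable]; rfl
  rw [e]
  infer_instance

/-- A Gaussian vector and an independent sequence of independent Gaussian variables, which is
independent of the vector, form a Gaussian process. -/
theorem isGaussianProcess_sumElim {X : Type*} [Fintype X] {F : X → Ω → ℝ} {w : ℕ → Ω → ℝ}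
    (hF : HasGaussianLaw (fun ω x => F x ω) P) (hw : ∀ j, HasGaussianLaw (w j) P)
    (hind : iIndepFun w P) (hFw : IndepFun (fun ω x => F x ω) (fun ω j => w j ω) P) :
    IsGaussianProcess (Sum.elim F w) P := by
  classical
  constructor
  intro I
  -- A finite index set meets finitely many noises, so its marginal is a linear image of a
  -- finite-dimensional Gaussian vector.
  obtain ⟨k, hk⟩ : ∃ k : ℕ, ∀ j, Sum.inr j ∈ I → j < k := by
    refine ⟨(I.sup fun t => Sum.elim (fun _ => 0) (fun j => j) t) + 1, fun j hj => ?_⟩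
    exact Nat.lt_succ_of_le (Finset.le_sup (f := fun t : X ⊕ ℕ =>
      Sum.elim (fun _ => 0) (fun j => j) t) hj)
  have hwk : HasGaussianLaw (fun ω (j : Fin k) => w j ω) P :=
    iIndepFun.hasGaussianLaw (fun j => hw j) (hind.precomp Fin.val_injective)
  have hFk : IndepFun (fun ω x => F x ω) (fun ω (j : Fin k) => w j ω) P :=
    hFw.comp (φ := id) (ψ := fun (u : ℕ → ℝ) (j : Fin k) => u j) measurable_id (by fun_prop)
  have hpair := IndepFun.hasGaussianLaw hF hwk hFk
  let L : ((X → ℝ) × (Fin k → ℝ)) →L[ℝ] (I → ℝ) := ContinuousLinearMap.pi fun s =>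
    match s with
    | ⟨Sum.inl x, _⟩ => (ContinuousLinearMap.proj x).comp (ContinuousLinearMap.fst ℝ _ _)
    | ⟨Sum.inr j, hj⟩ =>
      (ContinuousLinearMap.proj ⟨j, hk j hj⟩).comp (ContinuousLinearMap.snd ℝ _ _)
  have e : (fun ω => I.restrict fun t => Sum.elim F w t ω) =
      L ∘ fun ω => (fun x => F x ω, fun j : Fin k => w j ω) := by
    ext ω ⟨s, hs⟩
    rcases s with x | j <;> simp [L]
  rw [e]
  exact hpair.map L

end GaussianSpan

/-! ### Covariance as a semidefinite bilinear form -/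

section SquareIntegrable

variable {Ω : Type*} [MeasurableSpace Ω]

/-- The space of square integrable functions. -/
def squareIntegrable (P : Measure Ω) : Submodule ℝ (Ω → ℝ) where
  carrier := {Z | MemLp Z 2 P}
  add_mem' h1 h2 := h1.add h2
  zero_mem' := MemLp.zero
  smul_mem' c _ h := h.const_smul c

/-- The covariance as a bilinear form. -/
noncomputable def covForm (P : Measure Ω) [IsProbabilityMeasure P] :
    LinearMap.BilinForm ℝ (squareIntegrable P) :=
  LinearMap.mk₂ ℝ (fun Z W => cov[(Z : Ω → ℝ), (W : Ω → ℝ); P])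
    (fun Z Z' W => covariance_add_left Z.2 Z'.2 W.2)
    (fun c _ _ => covariance_smul_left c)
    (fun Z W W' => covariance_add_right Z.2 W.2 W'.2)
    (fun c _ _ => covariance_smul_right c)

variable {P : Measure Ω} [IsProbabilityMeasure P]

theorem covForm_apply (Z W : squareIntegrable P) :
    covForm P Z W = cov[(Z : Ω → ℝ), (W : Ω → ℝ); P] := rfl

theorem covForm_comm (Z W : squareIntegrable P) : covForm P Z W = covForm P W Z :=
  covariance_comm _ _

theorem covForm_self_nonneg (Z : squareIntegrable P) : 0 ≤ covForm P Z Z := by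
  rw [covForm_apply, covariance_self Z.2.aestronglyMeasurable.aemeasurable]
  exact variance_nonneg _ _

end SquareIntegrable

/-! ### Independence tools -/

section Independence

variable {Ω α β γ : Type*} {mΩ : MeasurableSpace Ω} [MeasurableSpace α] [MeasurableSpace β]
  [MeasurableSpace γ] {P : Measure Ω}

/-- The joint law of the triple factors completely, and products of measures may be reassociated.
Used repeatedly to regroup the independent sources of the model. -/
theorem indepFun_prodMk_right [IsProbabilityMeasure P] {a : Ω → α} {b : Ω → β} {c : Ω → γ}
    (ha : Measurable a) (hb : Measurable b) (hc : Measurable c) (hab : IndepFun a b P)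
    (h : IndepFun (fun ω => (a ω, b ω)) c P) : IndepFun a (fun ω => (b ω, c ω)) P := by
  have hbc : IndepFun b c P := h.comp (φ := Prod.snd) (ψ := id) measurable_snd measurable_id
  rw [indepFun_iff_map_prod_eq_prod_map_map ha.aemeasurable (hb.prodMk hc).aemeasurable]
  have h1 := (indepFun_iff_map_prod_eq_prod_map_map (ha.prodMk hb).aemeasurable
    hc.aemeasurable).1 h
  rw [(indepFun_iff_map_prod_eq_prod_map_map ha.aemeasurable hb.aemeasurable).1 hab] at h1
  rw [(indepFun_iff_map_prod_eq_prod_map_map hb.aemeasurable hc.aemeasurable).1 hbc]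
  have := Measure.isProbabilityMeasure_map (μ := P) ha.aemeasurable
  have := Measure.isProbabilityMeasure_map (μ := P) hb.aemeasurable
  have := Measure.isProbabilityMeasure_map (μ := P) hc.aemeasurable
  rw [← Measure.prodAssoc_prod, ← h1,
    Measure.map_map MeasurableEquiv.prodAssoc.measurable ((ha.prodMk hb).prodMk hc)]
  rfl

theorem setIntegral_eq_of_indep [IsProbabilityMeasure P] {m₁ m₂ : MeasurableSpace Ω}
    (h₁ : m₁ ≤ mΩ) (h₂ : m₂ ≤ mΩ) (hind : Indep m₁ m₂ P) {F : Ω → ℝ}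
    (hF : Measurable[m₁] F) (hFi : Integrable F P) {C : Set Ω} (hC : MeasurableSet[m₂] C) :
    ∫ ω in C, F ω ∂P = P.real C * ∫ ω, F ω ∂P := by
  rw [← setIntegral_condExp h₂ hFi hC,
    setIntegral_congr_ae (g := fun _ => ∫ ω, F ω ∂P) (h₂ _ hC)
      ((condExp_indep_eq h₁ h₂ hF.stronglyMeasurable hind).mono fun ω h _ => h),
    setIntegral_const, smul_eq_mul]

end Independence

/-! ### Fixed designs: the posterior error is independent of the data -/

section Model

variable {X Ω S : Type*} [MeasurableSpace Ω] [MeasurableSpace S]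
  {P : Measure Ω} {σ2 : X → ℝ≥0} {f : X → Ω → ℝ} {v : ℕ → X → Ω → ℝ}
  {E : ℕ → ℕ → Ω → ℝ} {U : Ω → S}

theorem IsModel.measurable_f_pi (h : IsModel P σ2 f v E U) : Measurable fun ω x => f x ω :=
  measurable_pi_lambda _ h.measurable_f

theorem IsModel.measurable_v_pi (h : IsModel P σ2 f v E U) : Measurable fun ω k x => v k x ω :=
  measurable_pi_lambda _ fun k => measurable_pi_lambda _ fun x => h.measurable_v k x

theorem IsModel.measurable_E_pi (h : IsModel P σ2 f v E U) : Measurable fun ω n i => E n i ω :=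
  measurable_pi_lambda _ fun n => measurable_pi_lambda _ fun i => h.measurable_E n i

theorem IsModel.hasGaussianLaw_v (h : IsModel P σ2 f v E U) (k : ℕ) (x : X) :
    HasGaussianLaw (v k x) P :=
  ⟨by rw [h.law_v]; infer_instance⟩

theorem IsModel.memLp_f (h : IsModel P σ2 f v E U) (x : X) : MemLp (f x) 2 P :=
  (h.gaussian_f.hasGaussianLaw_eval x).memLp_two

theorem IsModel.integrable_f (h : IsModel P σ2 f v E U) (x : X) : Integrable (f x) P :=
  (h.gaussian_f.hasGaussianLaw_eval x).integrable

theorem IsModel.integral_v (h : IsModel P σ2 f v E U) (k : ℕ) (x : X) : ∫ ω, v k x ω ∂P = 0 := by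
  have := (HasLaw.mk (h.measurable_v k x).aemeasurable (h.law_v k x)).integral_eq
  simpa using this

theorem IsModel.variance_v (h : IsModel P σ2 f v E U) (k : ℕ) (x : X) :
    Var[v k x; P] = σ2 x := by
  have := (HasLaw.mk (h.measurable_v k x).aemeasurable (h.law_v k x)).variance_eq
  simpa using this

theorem IsModel.indepFun_f_v (h : IsModel P σ2 f v E U) :
    IndepFun (fun ω x => f x ω) (fun ω k x => v k x ω) P :=
  h.indep_f.comp (φ := id) (ψ := Prod.fst) measurable_id measurable_fst

/-- The observations for a fixed design. -/
def obs (f : X → Ω → ℝ) (v : ℕ → X → Ω → ℝ) (a : ℕ → X) (j : ℕ) (ω : Ω) : ℝ :=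
  f (a j) ω + v j (a j) ω

/-- The posterior given the first `k` observations at arbitrary points. -/
noncomputable def state (P : Measure Ω) (σ2 : X → ℝ≥0) (f : X → Ω → ℝ) (x : ℕ → Ω → X)
    (y : ℕ → Ω → ℝ) (k : ℕ) (ω : Ω) : GPState X :=
  posterior σ2 (priorOf P f) (dataList x y k ω)

theorem state_succ (x : ℕ → Ω → X) (y : ℕ → Ω → ℝ) (k : ℕ) (ω : Ω) :
    state P σ2 f x y (k + 1) ω = update σ2 (state P σ2 f x y k ω) (x k ω, y k ω) := by
  simp [state, posterior, dataList, List.range_succ]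

theorem IsModel.measurable_obs (h : IsModel P σ2 f v E U) (a : ℕ → X) (j : ℕ) :
    Measurable (obs f v a j) :=
  (h.measurable_f (a j)).add (h.measurable_v j (a j))

/-- The information for a fixed design: its first `k` observations and the randomization. -/
@[reducible] def designSigma (f : X → Ω → ℝ) (v : ℕ → X → Ω → ℝ) (E : ℕ → ℕ → Ω → ℝ) (U : Ω → S)
    (a : ℕ → X) (k : ℕ) : MeasurableSpace Ω :=
  MeasurableSpace.comap (fun ω => (fun j : Fin k => obs f v a j ω, (fun n i => E n i ω, U ω)))
    inferInstance

theorem IsModel.designSigma_le (h : IsModel P σ2 f v E U) (a : ℕ → X) (k : ℕ) :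
    designSigma f v E U a k ≤ ‹MeasurableSpace Ω› :=
  ((measurable_pi_lambda _ fun j : Fin k => h.measurable_obs a j).prodMk
    (h.measurable_E_pi.prodMk h.measurable_U)).comap_le

variable [IsProbabilityMeasure P]

theorem IsModel.indepFun_process_samples (h : IsModel P σ2 f v E U) :
    IndepFun (fun ω => (fun k x => v k x ω, fun x => f x ω))
      (fun ω => (fun n i => E n i ω, U ω)) P := by
  have hE := h.measurable_E_pi
  have hv := h.measurable_v_pi
  have hf := h.measurable_f_pi
  have h1 : IndepFun (fun ω n i => E n i ω) (fun ω => (fun k x => v k x ω, fun x => f x ω)) P :=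
    indepFun_prodMk_right hE hv hf h.indep_v_E.symm
      (h.indep_f.symm.comp (φ := Prod.swap) (ψ := id) measurable_swap measurable_id)
  refine indepFun_prodMk_right (hv.prodMk hf) hE h.measurable_U h1.symm ?_
  exact h.indep_U.symm.comp (φ := fun q => ((q.2.1, q.1), q.2.2)) (ψ := id) (by fun_prop)
    measurable_id

/-- The second tuple contains every source from which the past of period `n` is built; see
`IsOKGRun.pastSigma_le`. -/
theorem IsModel.indepFun_samples_period (h : IsModel P σ2 f v E U) (n : ℕ) :
    IndepFun (fun ω i => E n i ω)
      (fun ω => ((((fun (j : Fin n) i => E j i ω), fun k x => v k x ω), fun x => f x ω), U ω))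
      P := by
  have hE := h.measurable_E_pi
  have hv := h.measurable_v_pi
  have hf := h.measurable_f_pi
  have hEn : Measurable fun ω i => E n i ω := measurable_pi_lambda _ fun i => h.measurable_E n i
  have hEj : Measurable fun ω (j : Fin n) i => E j i ω :=
    measurable_pi_lambda _ fun j => measurable_pi_lambda _ fun i => h.measurable_E j i
  have h0 : IndepFun (fun ω i => E n i ω) (fun ω (j : Fin n) i => E j i ω) P := by
    have hd : Disjoint {a : ℕ × ℕ | a.1 = n} {a : ℕ × ℕ | a.1 < n} := by
      rw [Set.disjoint_left]
      rintro ⟨i, j⟩ h1 h2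
      simp only [Set.mem_ofPred_eq] at h1 h2
      omega
    have hi := indep_iSup_of_disjoint (fun a : ℕ × ℕ => (h.measurable_E a.1 a.2).comap_le)
      h.indep_E.iIndep hd
    rw [IndepFun_iff_Indep]
    refine indep_of_indep_of_le_left (indep_of_indep_of_le_right hi ?_) ?_
    · rw [← measurable_iff_comap_le]
      refine @measurable_pi_lambda _ _ _ (_) _ _ fun j =>
        @measurable_pi_lambda _ _ _ (_) _ _ fun i => ?_
      refine Measurable.mono (comap_measurable (E j i)) ?_ le_rfl
      exact le_iSup₂_of_le (f := fun (a : ℕ × ℕ) (_ : a ∈ {a : ℕ × ℕ | a.1 < n}) =>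
        MeasurableSpace.comap (fun ω => E a.1 a.2 ω) inferInstance) ((j : ℕ), i) j.2 le_rfl
    · rw [← measurable_iff_comap_le]
      refine @measurable_pi_lambda _ _ _ (_) _ _ fun i => ?_
      refine Measurable.mono (comap_measurable (E n i)) ?_ le_rfl
      exact le_iSup₂_of_le (f := fun (a : ℕ × ℕ) (_ : a ∈ {a : ℕ × ℕ | a.1 = n}) =>
        MeasurableSpace.comap (fun ω => E a.1 a.2 ω) inferInstance) (n, i) rfl le_rfl
  have h1 := indepFun_prodMk_right hEn hEj hv h0
    (h.indep_v_E.symm.comp (φ := fun e => (e n, fun j : Fin n => e j)) (ψ := id)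
      (by fun_prop) measurable_id)
  have h2 := indepFun_prodMk_right hEn (hEj.prodMk hv) hf h1
    (h.indep_f.symm.comp (φ := fun q => (q.2 n, ((fun j : Fin n => q.2 j), q.1))) (ψ := id)
      (by fun_prop) measurable_id)
  exact indepFun_prodMk_right hEn ((hEj.prodMk hv).prodMk hf) h.measurable_U h2
    (h.indep_U.symm.comp
      (φ := fun q => (q.2.2 n, (((fun j : Fin n => q.2.2 j), q.2.1), q.1))) (ψ := id)
      (by fun_prop) measurable_id)

/-- The centered values of the process. -/
noncomputable def IsModel.centered (h : IsModel P σ2 f v E U) (x : X) : squareIntegrable P :=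
  ⟨fun ω => f x ω - ∫ ω, f x ω ∂P, (h.memLp_f x).sub (memLp_const _)⟩

/-- The noise of the measurements at the points of a fixed design. -/
noncomputable def IsModel.noise (h : IsModel P σ2 f v E U) (a : ℕ → X) (j : ℕ) :
    squareIntegrable P :=
  ⟨v j (a j), (h.hasGaussianLaw_v j (a j)).memLp_two⟩

/-- The differences between the process and its posterior mean for a fixed design. -/
noncomputable def IsModel.resid (h : IsModel P σ2 f v E U) (a : ℕ → X) (k : ℕ) (z : X) :
    squareIntegrable P :=
  residual (covForm P) σ2 h.centered (h.noise a) a k z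

theorem IsModel.covForm_centered_noise (h : IsModel P σ2 f v E U) (a : ℕ → X) (j : ℕ) (x : X) :
    covForm P (h.centered x) (h.noise a j) = 0 := by
  refine IndepFun.covariance_eq_zero ?_ (h.centered x).2 (h.noise a j).2
  exact h.indepFun_f_v.comp (φ := fun u => u x - ∫ ω, f x ω ∂P) (ψ := fun w => w j (a j))
    (by fun_prop) (by fun_prop)

theorem IsModel.covForm_noise_noise (h : IsModel P σ2 f v E U) (a : ℕ → X) {i j : ℕ}
    (hij : i ≠ j) : covForm P (h.noise a i) (h.noise a j) = 0 := by
  refine IndepFun.covariance_eq_zero ?_ (h.noise a i).2 (h.noise a j).2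
  exact (h.indep_v.indepFun hij).comp (φ := fun u : X → ℝ => u (a i)) (ψ := fun w : X → ℝ => w (a j))
    (measurable_pi_apply _) (measurable_pi_apply _)

theorem IsModel.covForm_noise_self (h : IsModel P σ2 f v E U) (a : ℕ → X) (j : ℕ) :
    covForm P (h.noise a j) (h.noise a j) = σ2 (a j) := by
  rw [covForm_apply, covariance_self (h.noise a j).2.aestronglyMeasurable.aemeasurable]
  exact h.variance_v j (a j)

theorem IsModel.resid_succ_apply (h : IsModel P σ2 f v E U) (a : ℕ → X) (k : ℕ) (z : X) (ω : Ω) :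
    (h.resid a (k + 1) z : Ω → ℝ) ω = (h.resid a k z : Ω → ℝ) ω -
      (covForm P (h.resid a k z) (h.resid a k (a k)) /
        (covForm P (h.resid a k (a k)) (h.resid a k (a k)) + σ2 (a k))) *
        ((h.resid a k (a k) : Ω → ℝ) ω + v k (a k) ω) := rfl

/-- For a fixed design the posterior covariance function is the covariance function of the
difference between the process and the posterior mean. -/
theorem IsModel.state_design (h : IsModel P σ2 f v E U) (a : ℕ → X) (k : ℕ) (ω : Ω) :
    (∀ z z', (state P σ2 f (fun j _ => a j) (obs f v a) k ω).2 z z' =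
      covForm P (h.resid a k z) (h.resid a k z')) ∧
    ∀ z, f z ω - (state P σ2 f (fun j _ => a j) (obs f v a) k ω).1 z =
      (h.resid a k z : Ω → ℝ) ω := by
  induction k with
  | zero =>
    refine ⟨fun z z' => ?_, fun z => rfl⟩
    change cov[f z, f z'; P] = cov[fun ω => f z ω - ∫ ω, f z ω ∂P,
      fun ω => f z' ω - ∫ ω, f z' ω ∂P; P]
    rw [covariance_sub_const_left (h.integrable_f z), covariance_sub_const_right (h.integrable_f z')]
  | succ k ih =>
    obtain ⟨ih2, ih1⟩ := ih
    rw [state_succ]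
    simp only [update]
    constructor
    · intro z z'
      simp only [ih2]
      exact (bilin_residual_succ covForm_comm covForm_self_nonneg
        (fun j x => h.covForm_centered_noise a j x) (fun i j hij => h.covForm_noise_noise a hij)
        (h.covForm_noise_self a) k z z').symm
    · intro z
      rw [h.resid_succ_apply, ← ih1 z, ← ih1 (a k), ih2, ih2, obs]
      ring

theorem IsModel.integral_resid (h : IsModel P σ2 f v E U) (a : ℕ → X) (k : ℕ) (z : X) :
    ∫ ω, (h.resid a k z : Ω → ℝ) ω ∂P = 0 := by
  have hint : ∀ k z, Integrable (h.resid a k z : Ω → ℝ) P := fun k z =>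
    (h.resid a k z).2.integrable one_le_two
  induction k generalizing z with
  | zero =>
    change ∫ ω, (f z ω - ∫ ω, f z ω ∂P) ∂P = 0
    rw [integral_sub (h.integrable_f z) (integrable_const _)]
    simp
  | succ k ih =>
    have hv : Integrable (v k (a k)) P := (h.hasGaussianLaw_v k (a k)).integrable
    simp only [h.resid_succ_apply]
    have hadd : Integrable (fun ω => (h.resid a k (a k) : Ω → ℝ) ω + v k (a k) ω) P :=
      (hint k (a k)).add hv
    rw [integral_sub (hint k z) (hadd.const_mul _), integral_const_mul,
      integral_add (hint k (a k)) hv, ih, ih, h.integral_v]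
    simp

/-- The residual involves neither base samples nor the extra randomization, so independence of the
data extends to independence of the data together with all randomization. -/
theorem IsModel.exists_resid_eq (h : IsModel P σ2 f v E U) (a : ℕ → X) (k : ℕ) :
    ∃ Ψ : X → (ℕ → X → ℝ) × (X → ℝ) → ℝ, (∀ z, Measurable (Ψ z)) ∧
      ∀ z ω, (h.resid a k z : Ω → ℝ) ω = Ψ z (fun k x => v k x ω, fun x => f x ω) := by
  induction k with
  | zero =>
    exact ⟨fun z q => q.2 z - ∫ ω, f z ω ∂P, fun z => by fun_prop, fun z ω => rfl⟩
  | succ k ih =>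
    obtain ⟨Ψ, hΨ, hr⟩ := ih
    refine ⟨fun z q => Ψ z q - (covForm P (h.resid a k z) (h.resid a k (a k)) /
        (covForm P (h.resid a k (a k)) (h.resid a k (a k)) + σ2 (a k))) *
        (Ψ (a k) q + q.1 k (a k)), fun z => ?_, fun z ω => ?_⟩
    · exact (hΨ z).sub (((hΨ (a k)).add (by fun_prop)).const_mul _)
    · rw [h.resid_succ_apply, hr, hr]

theorem IsModel.measurable_resid (h : IsModel P σ2 f v E U) (a : ℕ → X) (k : ℕ) :
    Measurable fun ω z => (h.resid a k z : Ω → ℝ) ω := by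
  obtain ⟨Ψ, hΨ, hr⟩ := h.exists_resid_eq a k
  refine measurable_pi_lambda _ fun z => ?_
  simp only [hr]
  exact (hΨ z).comp (h.measurable_v_pi.prodMk h.measurable_f_pi)

variable [Fintype X]

/-- Residuals and centered observations lie in the span of one Gaussian process and are uncorrelated
by `bilin_residual_span`, hence independent; adding the prior means back changes nothing. -/
theorem IsModel.indepFun_resid_obs (h : IsModel P σ2 f v E U) (a : ℕ → X) (k : ℕ) :
    IndepFun (fun ω z => (h.resid a k z : Ω → ℝ) ω) (fun ω (j : Fin k) => obs f v a j ω) P := by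
  set ξ : X ⊕ ℕ → Ω → ℝ := Sum.elim (fun x => (h.centered x : Ω → ℝ))
    (fun j => (h.noise a j : Ω → ℝ))
  have hfG : HasGaussianLaw (fun ω x => f x ω) P := by
    let L : (↥(Finset.univ : Finset X) → ℝ) →L[ℝ] (X → ℝ) :=
      ContinuousLinearMap.pi fun x =>
        ContinuousLinearMap.proj (⟨x, Finset.mem_univ x⟩ : (Finset.univ : Finset X))
    exact (h.gaussian_f.hasGaussianLaw Finset.univ).map L
  have hG : IsGaussianProcess ξ P := by
    refine isGaussianProcess_sumElim
      (hasGaussianLaw_sub_const hfG fun x => ∫ ω, f x ω ∂P)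
      (fun j => h.hasGaussianLaw_v j (a j)) ?_ ?_
    · exact h.indep_v.comp (fun j (w : X → ℝ) => w (a j)) fun j => measurable_pi_apply _
    · exact h.indepFun_f_v.comp (φ := fun u x => u x - ∫ ω, f x ω ∂P)
        (ψ := fun w j => w j (a j)) (by fun_prop) (by fun_prop)
  have hspan : ∀ Z : squareIntegrable P,
      Z ∈ Submodule.span ℝ (Set.range (Sum.elim h.centered (h.noise a))) →
      (Z : Ω → ℝ) ∈ Submodule.span ℝ (Set.range ξ) := by
    intro Z hZ
    have := Submodule.apply_mem_span_image_of_mem_span (squareIntegrable P).subtype hZ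
    rw [← Set.range_comp] at this
    have e : ξ = (squareIntegrable P).subtype ∘ Sum.elim h.centered (h.noise a) := by
      ext (x | j) <;> rfl
    rw [e]
    exact this
  have hY : ∀ j, h.centered (a j) + h.noise a j ∈
      Submodule.span ℝ (Set.range (Sum.elim h.centered (h.noise a))) := fun j =>
    Submodule.add_mem _ (Submodule.subset_span ⟨Sum.inl (a j), rfl⟩)
      (Submodule.subset_span ⟨Sum.inr j, rfl⟩)
  have hjoint : IsGaussianProcess (Sum.elim (fun z => (h.resid a k z : Ω → ℝ))
      (fun j : Fin k => ((h.centered (a j) + h.noise a j : squareIntegrable P) : Ω → ℝ))) P := by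
    refine isGaussianProcess_of_mem_span hG ?_
    rintro (z | j)
    · exact hspan _ (residual_mem_span k z)
    · exact hspan _ (hY j)
  have hind := hjoint.indepFun_of_covariance_eq_zero
    (fun z => (h.resid a k z).2.aestronglyMeasurable.aemeasurable)
    (fun j => (h.centered (a j) + h.noise a j).2.aestronglyMeasurable.aemeasurable)
    (fun z j => bilin_residual_span covForm_comm covForm_self_nonneg
        (fun j x => h.covForm_centered_noise a j x) (fun i j hij => h.covForm_noise_noise a hij)
        (h.covForm_noise_self a) k z (Submodule.subset_span ⟨j, j.2, rfl⟩))
  have := hind.comp (φ := id) (ψ := fun u (j : Fin k) => u j + ∫ ω, f (a j) ω ∂P) measurable_id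
    (by fun_prop)
  have e : (fun ω (j : Fin k) => obs f v a j ω) = fun ω (j : Fin k) =>
      (f (a j) ω - ∫ ω, f (a j) ω ∂P) + v j (a j) ω + ∫ ω, f (a j) ω ∂P := by
    funext ω j
    rw [obs]
    ring
  rw [e]
  exact this

theorem IsModel.indep_resid_designSigma (h : IsModel P σ2 f v E U) (a : ℕ → X) (k : ℕ) :
    Indep (MeasurableSpace.comap (fun ω z => (h.resid a k z : Ω → ℝ) ω) inferInstance)
      (designSigma f v E U a k) P := by
  have hY : Measurable fun ω (j : Fin k) => obs f v a j ω :=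
    measurable_pi_lambda _ fun j : Fin k => h.measurable_obs a j
  refine (IndepFun_iff_Indep _ _ _).1 (indepFun_prodMk_right (h.measurable_resid a k) hY
    (h.measurable_E_pi.prodMk h.measurable_U) (h.indepFun_resid_obs a k) ?_)
  obtain ⟨Ψ, hΨ, hr⟩ := h.exists_resid_eq a k
  simp only [hr]
  exact h.indepFun_process_samples.comp
    (φ := fun q => (fun z => Ψ z q, fun j : Fin k => q.2 (a j) + q.1 j (a j))) (ψ := id)
    ((measurable_pi_lambda _ hΨ).prodMk (measurable_pi_lambda _ fun j => by fun_prop))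
    measurable_id

theorem IsModel.setIntegral_resid (h : IsModel P σ2 f v E U) (a : ℕ → X) (k : ℕ)
    {φ : (X → ℝ) → ℝ} (hφ : Measurable φ)
    (hi : Integrable (fun ω => φ fun z => (h.resid a k z : Ω → ℝ) ω) P) {C : Set Ω}
    (hC : MeasurableSet[designSigma f v E U a k] C) :
    ∫ ω in C, φ (fun z => (h.resid a k z : Ω → ℝ) ω) ∂P =
      P.real C * ∫ ω, φ (fun z => (h.resid a k z : Ω → ℝ) ω) ∂P :=
  setIntegral_eq_of_indep (h.measurable_resid a k).comap_le
    (h.designSigma_le a k) (h.indep_resid_designSigma a k) (hφ.comp (comap_measurable _)) hi hC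

end Model

/-! ### Measurability with respect to the data -/

section Measurability

variable {X Ω : Type*} {m : MeasurableSpace Ω}

theorem measurable_apply_discrete [Finite X] {α : Type*} [MeasurableSpace α] {x : Ω → X}
    (hx : Measurable[m, ⊤] x) {g : X → Ω → α} (hg : ∀ z, Measurable (g z)) :
    Measurable fun ω => g (x ω) ω := by
  let _ : MeasurableSpace X := ⊤
  have : MeasurableSingletonClass X := ⟨fun _ => trivial⟩
  have : Measurable fun q : X × Ω => g q.1 q.2 := measurable_from_prod_countable_right hg
  exact this.comp (hx.prodMk measurable_id)

theorem measurable_apply_add_apply [Finite X] {x : Ω → X} (hx : Measurable[m, ⊤] x)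
    {g h : X → Ω → ℝ} (hg : ∀ z, Measurable (g z)) (hh : ∀ z, Measurable (h z)) :
    Measurable fun ω => g (x ω) ω + h (x ω) ω :=
  (measurable_apply_discrete hx hg).add (measurable_apply_discrete hx hh)

theorem measurable_comap_comp {α β : Type*} [MeasurableSpace α] [MeasurableSpace β] (W : Ω → α)
    {g : α → β} (hg : Measurable g) :
    Measurable[MeasurableSpace.comap W inferInstance] fun ω => g (W ω) :=
  hg.comp (comap_measurable W)

theorem measurable_posterior [Finite X] (σ2 : X → ℝ≥0) (p : GPState X) {x : ℕ → Ω → X}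
    {y : ℕ → Ω → ℝ} {k : ℕ} (hx : ∀ j < k, Measurable[m, ⊤] (x j))
    (hy : ∀ j < k, Measurable (y j)) :
    Measurable fun ω => posterior σ2 p (dataList x y k ω) := by
  induction k with
  | zero => exact measurable_const
  | succ k ih =>
    have ih := ih (fun j hj => hx j (Nat.lt_succ_of_lt hj)) fun j hj => hy j (Nat.lt_succ_of_lt hj)
    simp only [posterior, dataList, List.range_succ, List.map_append, List.map_cons, List.map_nil,
      List.foldl_append, List.foldl_cons, List.foldl_nil]
    refine measurable_apply_discrete (hx k (Nat.lt_succ_self k))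
      (g := fun z ω => update σ2 (posterior σ2 p (dataList x y k ω)) (z, y k ω)) fun z => ?_
    have hu : Measurable fun q : GPState X × ℝ => update σ2 q.1 (z, q.2) := by
      simp only [update]; fun_prop
    exact hu.comp (ih.prodMk (hy k (Nat.lt_succ_self k)))

theorem dataSigma_succ_le {x : ℕ → Ω → X} {y : ℕ → Ω → ℝ} {k : ℕ} (h : dataSigma x y k ≤ m)
    (hx : Measurable[m, ⊤] (x k)) (hy : Measurable (y k)) : dataSigma x y (k + 1) ≤ m := by
  refine iSup_le fun j => ?_
  rcases Nat.lt_succ_iff_lt_or_eq.1 j.2 with hj | hj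
  · exact (le_iSup (fun j : Fin k => MeasurableSpace.comap (x j) ⊤ ⊔
      MeasurableSpace.comap (y j) inferInstance) ⟨j, hj⟩).trans h
  · rw [hj]
    exact sup_le hx.comap_le hy.comap_le

theorem dataSigma_zero_le {x : ℕ → Ω → X} {y : ℕ → Ω → ℝ} : dataSigma x y 0 ≤ m :=
  iSup_le fun j => j.elim0

theorem measurable_point {x : ℕ → Ω → X} {y : ℕ → Ω → ℝ} {j k : ℕ} (h : j < k) :
    Measurable[dataSigma x y k, ⊤] (x j) := by
  rw [measurable_iff_comap_le]
  exact le_sup_left.trans (le_iSup (fun j : Fin k => MeasurableSpace.comap (x j) ⊤ ⊔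
      MeasurableSpace.comap (y j) inferInstance) ⟨j, h⟩)

theorem measurable_value {x : ℕ → Ω → X} {y : ℕ → Ω → ℝ} {j k : ℕ} (h : j < k) :
    Measurable[dataSigma x y k] (y j) := by
  rw [measurable_iff_comap_le]
  exact le_sup_right.trans (le_iSup (fun j : Fin k => MeasurableSpace.comap (x j) ⊤ ⊔
      MeasurableSpace.comap (y j) inferInstance) ⟨j, h⟩)

theorem dataSigma_mono (x : ℕ → Ω → X) (y : ℕ → Ω → ℝ) {k l : ℕ} (h : k ≤ l) :
    dataSigma x y k ≤ dataSigma x y l :=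
  iSup_le fun j => sup_le (measurable_iff_comap_le.1 (measurable_point (j.2.trans_le h)))
    (measurable_iff_comap_le.1 (measurable_value (j.2.trans_le h)))

/-- The sets whose intersection with `s` belongs to `m`. -/
@[reducible] def traceSpace (m : MeasurableSpace Ω) {s : Set Ω} (hs : MeasurableSet[m] s) :
    MeasurableSpace Ω where
  MeasurableSet' G := MeasurableSet[m] (G ∩ s)
  measurableSet_empty := by simp
  measurableSet_compl G hG := by
    have : Gᶜ ∩ s = s \ (G ∩ s) := by ext ω; simp; tauto
    rw [this]
    exact hs.diff hG
  measurableSet_iUnion G hG := by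
    rw [Set.iUnion_inter]
    exact MeasurableSet.iUnion hG

theorem le_traceSpace {s : Set Ω} (hs : MeasurableSet[m] s) : m ≤ traceSpace m hs :=
  fun _ hG => MeasurableSet.inter hG hs

end Measurability

/-! ### Adaptive measurements, reduced to fixed designs -/

section Run

variable {X Ω S : Type*} [mΩ : MeasurableSpace Ω] [MeasurableSpace S]
  {P : Measure Ω} {σ2 : X → ℝ≥0} {f : X → Ω → ℝ} {v : ℕ → X → Ω → ℝ}
  {E : ℕ → ℕ → Ω → ℝ} {U : Ω → S} {x : ℕ → Ω → X} {y : ℕ → Ω → ℝ}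

/-- The information given by all randomization and the first `k` data points. -/
@[reducible] def fullPast (E : ℕ → ℕ → Ω → ℝ) (U : Ω → S) (x : ℕ → Ω → X) (y : ℕ → Ω → ℝ)
    (k : ℕ) : MeasurableSpace Ω :=
  MeasurableSpace.comap U inferInstance ⊔ (⨆ n, sampleSigma E n) ⊔ dataSigma x y k

/-- Measurements at points which are chosen without looking ahead. -/
structure IsAdapted (f : X → Ω → ℝ) (v : ℕ → X → Ω → ℝ) (E : ℕ → ℕ → Ω → ℝ) (U : Ω → S)
    (x : ℕ → Ω → X) (y : ℕ → Ω → ℝ) : Prop where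
  observation : ∀ k ω, y k ω = f (x k ω) ω + v k (x k ω) ω
  nonanticipating : ∀ k, Measurable[fullPast E U x y k, ⊤] (x k)

/-- The event that the first `k` measurements are taken at the points `a`. -/
def visited (x : ℕ → Ω → X) (a : ℕ → X) (k : ℕ) : Set Ω := {ω | ∀ j < k, x j ω = a j}

omit mΩ in
theorem designSigma_mono (a : ℕ → X) (k : ℕ) :
    designSigma f v E U a k ≤ designSigma f v E U a (k + 1) := by
  have hg : Measurable fun q : (Fin (k + 1) → ℝ) × ((ℕ → ℕ → ℝ) × S) =>
      ((fun j : Fin k => q.1 j.castSucc), q.2) := by fun_prop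
  rw [← measurable_iff_comap_le]
  exact hg.comp (comap_measurable
    (fun ω => (fun j : Fin (k + 1) => obs f v a j ω, (fun n i => E n i ω, U ω))))

omit mΩ in
-- Where the design `a` has been followed, the adaptive data are the data of that design. The two
-- claims need each other in the induction: the next point is measurable for the adaptive past,
-- whose trace on `visited` lies in the design information.
theorem IsAdapted.measurableSet_visited_and_inter (h : IsAdapted f v E U x y) (a : ℕ → X)
    (k : ℕ) : MeasurableSet[designSigma f v E U a k] (visited x a k) ∧
      ∀ G, MeasurableSet[fullPast E U x y k] G →
        MeasurableSet[designSigma f v E U a k] (G ∩ visited x a k) := by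
  have key : ∀ k, MeasurableSet[designSigma f v E U a k] (visited x a k) →
      ∀ G, MeasurableSet[fullPast E U x y k] G →
        MeasurableSet[designSigma f v E U a k] (G ∩ visited x a k) := by
    intro k hk
    have hW := comap_measurable (m := inferInstance)
      (fun ω => (fun j : Fin k => obs f v a j ω, (fun n i => E n i ω, U ω)))
    have hle := le_traceSpace hk
    -- Sets with measurable trace form a σ-algebra, so only generators have to be checked.
    suffices fullPast E U x y k ≤ traceSpace (designSigma f v E U a k) hk from this
    refine sup_le (sup_le ?_ (iSup_le fun n => iSup_le fun i => ?_)) (iSup_le fun j =>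
      sup_le ?_ ?_)
    · exact le_trans (measurable_iff_comap_le.1 (measurable_snd.comp (measurable_snd.comp hW))) hle
    · exact le_trans (measurable_iff_comap_le.1 ((measurable_pi_apply i).comp
        ((measurable_pi_apply n).comp (measurable_fst.comp (measurable_snd.comp hW))))) hle
    · rintro _ ⟨B, -, rfl⟩
      change MeasurableSet[designSigma f v E U a k] (x j ⁻¹' B ∩ visited x a k)
      by_cases hB : a j ∈ B
      · have : x j ⁻¹' B ∩ visited x a k = visited x a k :=
          Set.inter_eq_right.2 fun ω hω => by rw [Set.mem_preimage, hω j j.2]; exact hB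
        rwa [this]
      · have : x j ⁻¹' B ∩ visited x a k = ∅ := by
          ext ω
          simp only [Set.mem_inter_iff, Set.mem_preimage, Set.mem_empty_iff_false, iff_false,
            not_and]
          intro h1 h2
          rw [h2 j j.2] at h1
          exact hB h1
        rw [this]
        exact @MeasurableSet.empty _ (_)
    · rintro _ ⟨B, hB, rfl⟩
      change MeasurableSet[designSigma f v E U a k] (y j ⁻¹' B ∩ visited x a k)
      have : y j ⁻¹' B ∩ visited x a k = obs f v a j ⁻¹' B ∩ visited x a k := by
        ext ω
        simp only [Set.mem_inter_iff, Set.mem_preimage, and_congr_left_iff]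
        intro hω
        rw [h.observation, hω j j.2, obs]
      rw [this]
      refine MeasurableSet.inter ?_ hk
      exact (measurable_pi_apply j).comp (measurable_fst.comp hW) hB
  suffices MeasurableSet[designSigma f v E U a k] (visited x a k) from ⟨this, key k this⟩
  induction k with
  | zero =>
    have : visited x a 0 = Set.univ := by ext; simp [visited]
    rw [this]
    exact @MeasurableSet.univ _ (_)
  | succ k ih =>
    have : visited x a (k + 1) = x k ⁻¹' {a k} ∩ visited x a k := by
      ext ω
      simp only [visited, Set.mem_ofPred_eq, Set.mem_inter_iff, Set.mem_preimage,
        Set.mem_singleton_iff]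
      constructor
      · exact fun hω => ⟨hω k (Nat.lt_succ_self k), fun j hj => hω j (Nat.lt_succ_of_lt hj)⟩
      · rintro ⟨h1, h2⟩ j hj
        rcases Nat.lt_succ_iff_lt_or_eq.1 hj with hj | rfl
        exacts [h2 j hj, h1]
    rw [this]
    exact designSigma_mono a k _ (key k ih _ (h.nonanticipating k trivial))

theorem IsAdapted.state_eq (h : IsAdapted f v E U x y) {a : ℕ → X} {k : ℕ} {ω : Ω}
    (hω : ω ∈ visited x a k) :
    state P σ2 f x y k ω = state P σ2 f (fun j _ => a j) (obs f v a) k ω := by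
  have : dataList x y k ω = dataList (fun j _ => a j) (obs f v a) k ω := by
    refine List.map_congr_left fun j hj => ?_
    rw [h.observation, hω j (List.mem_range.1 hj), obs]
  rw [state, state, this]

theorem IsModel.dataSigma_le_of [Finite X] (hm : IsModel P σ2 f v E U)
    (h : IsAdapted f v E U x y) (k : ℕ) : dataSigma x y k ≤ mΩ := by
  induction k with
  | zero => exact dataSigma_zero_le
  | succ k ih =>
    have hE : (⨆ n, sampleSigma E n) ≤ mΩ :=
      iSup_le fun n => iSup_le fun i => (hm.measurable_E n i).comap_le
    have hx : Measurable[mΩ, ⊤] (x k) :=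
      (h.nonanticipating k).mono (sup_le (sup_le hm.measurable_U.comap_le hE) ih) le_rfl
    refine dataSigma_succ_le ih hx ?_
    have : y k = fun ω => f (x k ω) ω + v k (x k ω) ω := funext (h.observation k)
    rw [this]
    exact measurable_apply_add_apply hx hm.measurable_f (hm.measurable_v k)

theorem measurable_state [Finite X] (P : Measure Ω) (σ2 : X → ℝ≥0) (f : X → Ω → ℝ) (x : ℕ → Ω → X)
    (y : ℕ → Ω → ℝ) (k : ℕ) : Measurable[dataSigma x y k] (state P σ2 f x y k) :=
  measurable_posterior σ2 (priorOf P f) (fun _ hj => measurable_point hj)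
    fun _ hj => measurable_value hj

theorem IsModel.sub_state_eq [IsProbabilityMeasure P] (hm : IsModel P σ2 f v E U) (h : IsAdapted f v E U x y) {a : ℕ → X}
    {k : ℕ} {ω : Ω} (hω : ω ∈ visited x a k) (z : X) :
    f z ω - (state P σ2 f x y k ω).1 z = (hm.resid a k z : Ω → ℝ) ω := by
  rw [h.state_eq hω]
  exact (hm.state_design a k ω).2 z

theorem IsModel.state_cov_eq [IsProbabilityMeasure P] (hm : IsModel P σ2 f v E U) (h : IsAdapted f v E U x y) {a : ℕ → X}
    {k : ℕ} {ω : Ω} (hω : ω ∈ visited x a k) (z z' : X) :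
    (state P σ2 f x y k ω).2 z z' = covForm P (hm.resid a k z) (hm.resid a k z') := by
  rw [h.state_eq hω]
  exact (hm.state_design a k ω).1 z z'

/-! ### Conditional moments of the process given adaptive data -/

section Decomposition

variable [Fintype X] [Nonempty X]

/-- A finite design, continued arbitrarily. -/
noncomputable def extendDesign {k : ℕ} (b : Fin k → X) (j : ℕ) : X :=
  if h : j < k then b ⟨j, h⟩ else Classical.arbitrary X

omit mΩ in
-- The events of having followed a given design of length `k` partition the sample space, and there
-- are finitely many of them.
theorem eq_sum_indicator_visited {k : ℕ} {F : Ω → ℝ} {G : (ℕ → X) → Ω → ℝ}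
    (hFG : ∀ a, ∀ ω ∈ visited x a k, F ω = G a ω) (ω : Ω) :
    F ω = ∑ b : Fin k → X, (visited x (extendDesign b) k).indicator (G (extendDesign b)) ω := by
  classical
  have hmem : ∀ b : Fin k → X, ω ∈ visited x (extendDesign b) k ↔ b = fun j : Fin k => x j ω := by
    intro b
    constructor
    · intro hb
      ext j
      have := hb j j.2
      simpa [extendDesign] using this.symm
    · rintro rfl j hj
      simp [extendDesign, hj]
  rw [Finset.sum_eq_single (fun j : Fin k => x j ω)]
  · rw [Set.indicator_of_mem ((hmem _).2 rfl)]
    exact hFG _ ω ((hmem _).2 rfl)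
  · intro b _ hb
    exact Set.indicator_of_notMem (fun hc => hb ((hmem b).1 hc)) _
  · intro hc
    exact absurd (Finset.mem_univ _) hc

/-- A statement about conditional means given the past can be checked for fixed designs. -/
theorem integral_eq_zero_of_design (hm : IsModel P σ2 f v E U) (h : IsAdapted f v E U x y) {k : ℕ}
    {F : Ω → ℝ} {G : (ℕ → X) → Ω → ℝ} (hFG : ∀ a, ∀ ω ∈ visited x a k, F ω = G a ω)
    (hG : ∀ a, Integrable (G a) P)
    (hG0 : ∀ a C, MeasurableSet[designSigma f v E U a k] C → ∫ ω in C, G a ω ∂P = 0) :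
    Integrable F P ∧ ∀ C, MeasurableSet[dataSigma x y k] C → ∫ ω in C, F ω ∂P = 0 := by
  have hF : F = fun ω => ∑ b : Fin k → X,
      (visited x (extendDesign b) k).indicator (G (extendDesign b)) ω :=
    funext (eq_sum_indicator_visited hFG)
  have hvis : ∀ a, MeasurableSet (visited x a k) := fun a =>
    hm.designSigma_le a k _ (h.measurableSet_visited_and_inter a k).1
  have hi : ∀ b : Fin k → X,
      Integrable ((visited x (extendDesign b) k).indicator (G (extendDesign b))) P := fun b =>
    (hG _).indicator (hvis _)
  constructor
  · rw [hF]
    exact integrable_finsetSum _ fun b _ => hi b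
  · intro C hC
    rw [hF, integral_finsetSum _ fun b _ => (hi b).integrableOn]
    refine Finset.sum_eq_zero fun b _ => ?_
    rw [setIntegral_indicator (hvis _)]
    refine hG0 _ _ ((h.measurableSet_visited_and_inter _ k).2 C ?_)
    exact (le_sup_right : dataSigma x y k ≤ fullPast E U x y k) _ hC

variable [IsProbabilityMeasure P]

theorem IsModel.integral_sub_state (hm : IsModel P σ2 f v E U) (h : IsAdapted f v E U x y)
    (k : ℕ) (z : X) : Integrable (fun ω => f z ω - (state P σ2 f x y k ω).1 z) P ∧
      ∀ C, MeasurableSet[dataSigma x y k] C →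
        ∫ ω in C, (f z ω - (state P σ2 f x y k ω).1 z) ∂P = 0 := by
  refine integral_eq_zero_of_design hm h (G := fun a => (hm.resid a k z : Ω → ℝ))
    (fun a ω hω => hm.sub_state_eq h hω z) (fun a => (hm.resid a k z).2.integrable one_le_two)
    fun a C hC => ?_
  have := hm.setIntegral_resid a k (φ := fun r => r z) (measurable_pi_apply z)
    ((hm.resid a k z).2.integrable one_le_two) hC
  rw [this, hm.integral_resid, mul_zero]

/-- The posterior mean function is the conditional mean, also for adaptively chosen points. -/
theorem IsModel.condExp_eq (hm : IsModel P σ2 f v E U) (h : IsAdapted f v E U x y) (k : ℕ)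
    (z : X) : P[f z | dataSigma x y k] =ᵐ[P] fun ω => (state P σ2 f x y k ω).1 z := by
  have hle := hm.dataSigma_le_of h k
  obtain ⟨hi, h0⟩ := hm.integral_sub_state h k z
  have hmeas : Measurable[dataSigma x y k] fun ω => (state P σ2 f x y k ω).1 z :=
    (measurable_pi_apply z).comp (measurable_fst.comp (measurable_state P σ2 f x y k))
  have hμ : Integrable (fun ω => (state P σ2 f x y k ω).1 z) P := by
    have := (hm.integrable_f z).sub hi
    refine this.congr (ae_of_all _ fun ω => ?_)
    simp
  refine (ae_eq_condExp_of_forall_setIntegral_eq hle (hm.integrable_f z)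
    (fun C _ _ => hμ.integrableOn) (fun C hC _ => ?_)
    hmeas.stronglyMeasurable.aestronglyMeasurable).symm
  have := h0 C hC
  rw [integral_sub (hm.integrable_f z).integrableOn hμ.integrableOn] at this
  linarith

/-- On each design, the bracket of covariances is the constant variance of a difference of centered
residuals. Only the mean over the whole space is needed later. -/
theorem IsModel.integral_sq_sub_state (hm : IsModel P σ2 f v E U) (h : IsAdapted f v E U x y)
    (k : ℕ) (z z' : X) :
    Integrable (fun ω => ((f z ω - (state P σ2 f x y k ω).1 z) -
        (f z' ω - (state P σ2 f x y k ω).1 z')) ^ 2 -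
      ((state P σ2 f x y k ω).2 z z - (state P σ2 f x y k ω).2 z z' -
        (state P σ2 f x y k ω).2 z' z + (state P σ2 f x y k ω).2 z' z')) P ∧
    ∫ ω, (((f z ω - (state P σ2 f x y k ω).1 z) -
        (f z' ω - (state P σ2 f x y k ω).1 z')) ^ 2 -
      ((state P σ2 f x y k ω).2 z z - (state P σ2 f x y k ω).2 z z' -
        (state P σ2 f x y k ω).2 z' z + (state P σ2 f x y k ω).2 z' z')) ∂P = 0 := by
  have hi : ∀ a, Integrable (fun ω => ((hm.resid a k z : Ω → ℝ) ω -
      (hm.resid a k z' : Ω → ℝ) ω) ^ 2) P := fun a =>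
    ((hm.resid a k z).2.sub (hm.resid a k z').2).integrable_sq
  refine (integral_eq_zero_of_design hm h (k := k)
    (F := fun ω => ((f z ω - (state P σ2 f x y k ω).1 z) -
        (f z' ω - (state P σ2 f x y k ω).1 z')) ^ 2 -
      ((state P σ2 f x y k ω).2 z z - (state P σ2 f x y k ω).2 z z' -
        (state P σ2 f x y k ω).2 z' z + (state P σ2 f x y k ω).2 z' z'))
    (G := fun a ω => ((hm.resid a k z : Ω → ℝ) ω - (hm.resid a k z' : Ω → ℝ) ω) ^ 2 -
      covForm P (hm.resid a k z - hm.resid a k z') (hm.resid a k z - hm.resid a k z'))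
    (fun a ω hω => ?_) (fun a => (hi a).sub (integrable_const _))
    fun a C hC => ?_).imp_right fun h2 => ?_
  · simp only [hm.sub_state_eq h hω, hm.state_cov_eq h hω, map_sub, LinearMap.sub_apply]
    ring
  · have := hm.setIntegral_resid a k (φ := fun r => (r z - r z') ^ 2) (by fun_prop) (hi a) hC
    rw [integral_sub (hi a).integrableOn (integrable_const _).integrableOn, this,
      setIntegral_const, smul_eq_mul, ← mul_sub]
    have hv : covForm P (hm.resid a k z - hm.resid a k z') (hm.resid a k z - hm.resid a k z') =
        ∫ ω, ((hm.resid a k z : Ω → ℝ) ω - (hm.resid a k z' : Ω → ℝ) ω) ^ 2 ∂P := by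
      have h0 : ∫ ω, ((hm.resid a k z : Ω → ℝ) ω - (hm.resid a k z' : Ω → ℝ) ω) ∂P = 0 := by
        rw [integral_sub ((hm.resid a k z).2.integrable one_le_two)
          ((hm.resid a k z').2.integrable one_le_two), hm.integral_resid, hm.integral_resid,
          sub_zero]
      have h3 := (hm.resid a k z - hm.resid a k z').2
      rw [covForm_apply, covariance_self h3.aestronglyMeasurable.aemeasurable]
      exact variance_of_integral_eq_zero h3.aestronglyMeasurable.aemeasurable h0
    rw [hv, sub_self, mul_zero]
  · rw [← setIntegral_univ]
    exact h2 _ (@MeasurableSet.univ _ (_))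

end Decomposition

end Run

/-! ### Averages over a random number of fresh samples -/

section Average

variable {Ω T : Type*} {mΩ : MeasurableSpace Ω} [MeasurableSpace T] {P : Measure Ω}
  [IsProbabilityMeasure P]

/-- Averages over a random number of fresh samples have the mean of a single sample. -/
theorem integral_average {q : Ω → T} {N : Ω → ℕ} {e : Ω → ℕ → ℝ} (hq : Measurable q)
    (hN : Measurable N) (he : Measurable e) (hind : IndepFun (fun ω => (q ω, N ω)) e P)
    {ν : Measure ℝ} (hlaw : ∀ i, P.map (fun ω => e ω i) = ν)
    (hpos : ∀ ω, 1 ≤ N ω) {g : T × ℝ → ℝ} (hg : Measurable g)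
    (hgi : ∀ t, Integrable (fun a => g (t, a)) ν) {C : ℝ}
    (hC : ∀ ω, ∫ a, |g (q ω, a)| ∂ν ≤ C) :
    Integrable (fun ω => (1 / (N ω : ℝ)) * ∑ i ∈ Finset.range (N ω), g (q ω, e ω i)) P ∧
      ∫ ω, (1 / (N ω : ℝ)) * ∑ i ∈ Finset.range (N ω), g (q ω, e ω i) ∂P =
        ∫ ω, (∫ a, g (q ω, a) ∂ν) ∂P := by
  set G : (T × ℕ) × (ℕ → ℝ) → ℝ := fun r =>
    (1 / (r.1.2 : ℝ)) * ∑ i ∈ Finset.range r.1.2, g (r.1.1, r.2 i) with hGdef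
  have hνp : IsProbabilityMeasure ν := by
    rw [← hlaw 0]
    exact Measure.isProbabilityMeasure_map ((measurable_pi_apply 0).comp he).aemeasurable
  have hG : Measurable G := by
    have h1 : Measurable fun r : (T × (ℕ → ℝ)) × ℕ =>
        (1 / (r.2 : ℝ)) * ∑ i ∈ Finset.range r.2, g (r.1.1, r.1.2 i) :=
      measurable_from_prod_countable_left fun n => by
        have hs : Measurable fun r : T × (ℕ → ℝ) => ∑ i ∈ Finset.range n, g (r.1, r.2 i) :=
          Finset.measurable_fun_sum _ fun i _ => hg.comp (by fun_prop)
        exact hs.const_mul (1 / (n : ℝ))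
    have h2 : Measurable fun r : (T × ℕ) × (ℕ → ℝ) => ((r.1.1, r.2), r.1.2) := by fun_prop
    exact h1.comp h2
  -- By independence the integral is one over a product law; state and sample size can be frozen
  -- while the samples are integrated out.
  have hqN : Measurable fun ω => (q ω, N ω) := hq.prodMk hN
  have hprod := (indepFun_iff_map_prod_eq_prod_map_map hqN.aemeasurable he.aemeasurable).1 hind
  set μE := P.map e
  set μq := P.map fun ω => (q ω, N ω)
  have : IsProbabilityMeasure μE := Measure.isProbabilityMeasure_map he.aemeasurable
  have : IsProbabilityMeasure μq := Measure.isProbabilityMeasure_map hqN.aemeasurable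
  have hmp : ∀ i, MeasurePreserving (fun u : ℕ → ℝ => u i) μE ν := fun i =>
    ⟨measurable_pi_apply i, by
      rw [Measure.map_map (measurable_pi_apply i) he]; exact hlaw i⟩
  have hint1 : ∀ t i, Integrable (fun u : ℕ → ℝ => g (t, u i)) μE := fun t i =>
    (hmp i).integrable_comp_of_integrable (hgi t)
  have hval : ∀ (φ : ℝ → ℝ), Measurable φ → ∀ i, ∫ u, φ (u i) ∂μE = ∫ a, φ a ∂ν := by
    intro φ hφ i
    rw [← (hmp i).map_eq, integral_map (measurable_pi_apply i).aemeasurable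
      hφ.aestronglyMeasurable]
  have hgt : ∀ t, Measurable fun a => g (t, a) := fun t => hg.comp measurable_prodMk_left
  have hGi : ∀ r, Integrable (fun u => G (r, u)) μE := fun r =>
    (integrable_finsetSum (Finset.range r.2) fun i _ => hint1 r.1 i).const_mul (1 / (r.2 : ℝ))
  have hmean : ∀ n : ℕ, 1 ≤ n → ∀ c : ℝ,
      (1 / (n : ℝ)) * ∑ i ∈ Finset.range n, c = c := by
    intro n hn c
    have : (n : ℝ) ≠ 0 := by positivity
    rw [Finset.sum_const, Finset.card_range, nsmul_eq_mul]
    field_simp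
  have hGval : ∀ ω, ∫ u, G ((q ω, N ω), u) ∂μE = ∫ a, g (q ω, a) ∂ν := by
    intro ω
    simp only [hGdef]
    rw [integral_const_mul, integral_finsetSum _ fun i _ => hint1 _ i]
    simp only [hval _ (hgt (q ω))]
    exact hmean _ (hpos ω) _
  have hGabs : ∀ ω, ∫ u, ‖G ((q ω, N ω), u)‖ ∂μE ≤ C := by
    intro ω
    refine le_trans ?_ (hC ω)
    have hi2 : Integrable (fun u : ℕ → ℝ =>
        (1 / (N ω : ℝ)) * ∑ i ∈ Finset.range (N ω), |g (q ω, u i)|) μE :=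
      (integrable_finsetSum _ fun i _ => (hint1 (q ω) i).abs).const_mul _
    calc ∫ u, ‖G ((q ω, N ω), u)‖ ∂μE
        ≤ ∫ u, (1 / (N ω : ℝ)) * ∑ i ∈ Finset.range (N ω), |g (q ω, u i)| ∂μE := by
          refine integral_mono (hGi _).norm hi2 fun u => ?_
          simp only [hGdef, Real.norm_eq_abs]
          rw [abs_mul, abs_of_nonneg (by positivity : (0 : ℝ) ≤ 1 / (N ω : ℝ))]
          exact mul_le_mul_of_nonneg_left (Finset.abs_sum_le_sum_abs _ _) (by positivity)
      _ = ∫ a, |g (q ω, a)| ∂ν := by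
          rw [integral_const_mul, integral_finsetSum _ fun i _ => (hint1 _ i).abs]
          simp only [hval (fun a => |g (q ω, a)|) (hgt (q ω)).abs]
          exact hmean _ (hpos ω) _
  have hGint : Integrable G (μq.prod μE) := by
    rw [integrable_prod_iff hG.aestronglyMeasurable]
    refine ⟨ae_of_all _ hGi, ?_⟩
    have hm1 : Measurable fun r : T × ℕ => ∫ u, ‖G (r, u)‖ ∂μE :=
      (hG.norm.stronglyMeasurable.integral_prod_right (ν := μE)).measurable
    rw [integrable_map_measure hm1.aestronglyMeasurable hqN.aemeasurable]
    refine (integrable_const C).mono' (hm1.comp hqN).aestronglyMeasurable (ae_of_all _ fun ω => ?_)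
    rw [Function.comp, Real.norm_eq_abs, abs_of_nonneg (integral_nonneg fun u => norm_nonneg _)]
    exact hGabs ω
  have hGm : Measurable fun r : T × ℕ => ∫ u, G (r, u) ∂μE :=
    (hG.stronglyMeasurable.integral_prod_right (ν := μE)).measurable
  have hpair : Measurable fun ω => ((q ω, N ω), e ω) := hqN.prodMk he
  constructor
  · rw [← hprod, integrable_map_measure hG.aestronglyMeasurable hpair.aemeasurable] at hGint
    exact hGint
  · calc ∫ ω, (1 / (N ω : ℝ)) * ∑ i ∈ Finset.range (N ω), g (q ω, e ω i) ∂P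
        = ∫ r, G r ∂(P.map fun ω => ((q ω, N ω), e ω)) := by
          rw [integral_map hpair.aemeasurable hG.aestronglyMeasurable]
      _ = ∫ r, ∫ u, G (r, u) ∂μE ∂μq := by rw [hprod, integral_prod _ hGint]
      _ = _ := by
          rw [integral_map hqN.aemeasurable hGm.aestronglyMeasurable]
          simp only [hGval]

end Average

section

variable {X Ω S : Type*} [Finite X] [mΩ : MeasurableSpace Ω] [MeasurableSpace S]
  {P : Measure Ω} {σ2 : X → ℝ≥0} {f : X → Ω → ℝ} {v : ℕ → X → Ω → ℝ}
  {E : ℕ → ℕ → Ω → ℝ} {U : Ω → S} {x : ℕ → Ω → X} {y : ℕ → Ω → ℝ}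

theorem IsModel.measurable_state (hm : IsModel P σ2 f v E U) (h : IsAdapted f v E U x y)
    (k : ℕ) : Measurable (state P σ2 f x y k) :=
  (OKG.measurable_state P σ2 f x y k).mono (hm.dataSigma_le_of h k) le_rfl

end

/-! ### Pathwise properties of the posterior covariance -/

section Path

variable {X Ω S : Type*} [mΩ : MeasurableSpace Ω] [MeasurableSpace S]
  {P : Measure Ω} [IsProbabilityMeasure P] {σ2 : X → ℝ≥0} {f : X → Ω → ℝ} {v : ℕ → X → Ω → ℝ}
  {E : ℕ → ℕ → Ω → ℝ} {U : Ω → S} {x : ℕ → Ω → X} {y : ℕ → Ω → ℝ}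

/-- Every outcome follows the design formed by its own points, so the random covariance function is,
outcome by outcome, that of a fixed design. The next lemmas use the same device. -/
theorem IsModel.state_cov_comm (hm : IsModel P σ2 f v E U) (h : IsAdapted f v E U x y) (k : ℕ)
    (ω : Ω) (z z' : X) : (state P σ2 f x y k ω).2 z z' = (state P σ2 f x y k ω).2 z' z := by
  have hω : ω ∈ visited x (fun j => x j ω) k := fun _ _ => rfl
  rw [hm.state_cov_eq h hω, hm.state_cov_eq h hω, covForm_comm]

theorem IsModel.state_cov_self_nonneg (hm : IsModel P σ2 f v E U) (h : IsAdapted f v E U x y)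
    (k : ℕ) (ω : Ω) (z : X) : 0 ≤ (state P σ2 f x y k ω).2 z z := by
  have hω : ω ∈ visited x (fun j => x j ω) k := fun _ _ => rfl
  rw [hm.state_cov_eq h hω]
  exact covForm_self_nonneg _

theorem IsModel.state_cov_sq_le (hm : IsModel P σ2 f v E U) (h : IsAdapted f v E U x y) (k : ℕ)
    (ω : Ω) (z z' : X) : (state P σ2 f x y k ω).2 z z' ^ 2 ≤
      (state P σ2 f x y k ω).2 z z * (state P σ2 f x y k ω).2 z' z' := by
  have hω : ω ∈ visited x (fun j => x j ω) k := fun _ _ => rfl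
  rw [hm.state_cov_eq h hω, hm.state_cov_eq h hω, hm.state_cov_eq h hω]
  exact bilin_sq_le covForm_comm covForm_self_nonneg _ _

/-- An observation subtracts a rank-one term, so for `z = z'` the squared slope is the drop of the
posterior variance. This identity couples the knowledge gradient to the loss of uncertainty. -/
theorem IsModel.state_cov_succ (hm : IsModel P σ2 f v E U) (h : IsAdapted f v E U x y) (k : ℕ)
    (ω : Ω) (z z' : X) : (state P σ2 f x y (k + 1) ω).2 z z' =
      (state P σ2 f x y k ω).2 z z' - slope σ2 (state P σ2 f x y k ω) (x k ω) z *
        slope σ2 (state P σ2 f x y k ω) (x k ω) z' := by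
  rw [state_succ]
  set p := state P σ2 f x y k ω with hp
  have h0 : 0 ≤ p.2 (x k ω) (x k ω) + σ2 (x k ω) :=
    add_nonneg (hm.state_cov_self_nonneg h k ω _) (σ2 _).coe_nonneg
  have hc : p.2 (x k ω) z' = p.2 z' (x k ω) := hm.state_cov_comm h k ω _ _
  simp only [update, slope]
  rw [hc]
  congr 1
  have hs := Real.mul_self_sqrt h0
  set s := p.2 (x k ω) (x k ω) + σ2 (x k ω)
  calc _ = p.2 z (x k ω) * p.2 z' (x k ω) * (s / s / s) := by
        rcases eq_or_ne s 0 with h | h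
        · simp [h]
        · rw [div_self h]; ring
    _ = p.2 z (x k ω) / s * (p.2 z' (x k ω) / s) * s := by ring
    _ = _ := by nth_rewrite 3 [← hs]; ring

theorem IsModel.slope_sq_le (hm : IsModel P σ2 f v E U) (h : IsAdapted f v E U x y) (k : ℕ)
    (ω : Ω) (x' z : X) :
    slope σ2 (state P σ2 f x y k ω) x' z ^ 2 ≤ (state P σ2 f x y k ω).2 z z := by
  set p := state P σ2 f x y k ω
  have h1 : 0 ≤ p.2 x' x' := hm.state_cov_self_nonneg h k ω x'
  have h2 : 0 ≤ p.2 z z := hm.state_cov_self_nonneg h k ω z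
  have h3 : p.2 z x' ^ 2 ≤ p.2 z z * p.2 x' x' := hm.state_cov_sq_le h k ω z x'
  have h4 : (0 : ℝ) ≤ σ2 x' := (σ2 x').coe_nonneg
  rw [slope_sq σ2 (add_nonneg h1 h4)]
  refine div_le_of_le_mul₀ (add_nonneg h1 h4) h2 (h3.trans ?_)
  exact mul_le_mul_of_nonneg_left (by linarith) h2

theorem IsModel.state_cov_self_le (hm : IsModel P σ2 f v E U) (h : IsAdapted f v E U x y) (k : ℕ)
    (ω : Ω) (z : X) : (state P σ2 f x y k ω).2 z z ≤ (priorOf P f).2 z z := by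
  induction k with
  | zero => exact le_rfl
  | succ k ih =>
    rw [hm.state_cov_succ h]
    nlinarith [mul_self_nonneg (slope σ2 (state P σ2 f x y k ω) (x k ω) z)]

/-- Along each path the posterior covariance function converges. -/
theorem IsModel.exists_tendsto_state_cov (hm : IsModel P σ2 f v E U)
    (h : IsAdapted f v E U x y) (ω : Ω) :
    ∃ L : X → X → ℝ, ∀ z z', Tendsto (fun k => (state P σ2 f x y k ω).2 z z') atTop
      (𝓝 (L z z')) := by
  set s : ℕ → X → ℝ := fun k z => slope σ2 (state P σ2 f x y k ω) (x k ω) z with hs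
  -- The sum telescopes to the total drop of variance, at most the prior variance.
  have hsq : ∀ z, Summable fun k => s k z ^ 2 := by
    intro z
    refine summable_of_sum_range_le (c := (priorOf P f).2 z z) (fun k => sq_nonneg _) fun n => ?_
    have : ∀ n, ∑ k ∈ Finset.range n, s k z ^ 2 =
        (priorOf P f).2 z z - (state P σ2 f x y n ω).2 z z := by
      intro n
      induction n with
      | zero => simp [state, posterior, dataList]
      | succ n ih =>
        rw [Finset.sum_range_succ, ih, hm.state_cov_succ h]
        ring
    rw [this]
    linarith [hm.state_cov_self_nonneg h n ω z]
  have hsum : ∀ z z', Summable fun k => s k z * s k z' := by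
    intro z z'
    refine Summable.of_norm_bounded ((hsq z).add (hsq z')) fun k => ?_
    rw [Real.norm_eq_abs, abs_le]
    constructor <;> nlinarith [sq_nonneg (s k z + s k z'), sq_nonneg (s k z - s k z'),
      sq_nonneg (s k z), sq_nonneg (s k z')]
  refine ⟨fun z z' => (priorOf P f).2 z z' - ∑' k, s k z * s k z', fun z z' => ?_⟩
  have : ∀ n, (state P σ2 f x y n ω).2 z z' =
      (priorOf P f).2 z z' - ∑ k ∈ Finset.range n, s k z * s k z' := by
    intro n
    induction n with
    | zero => simp [state, posterior, dataList]
    | succ n ih =>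
      rw [Finset.sum_range_succ, hm.state_cov_succ h, ih]
      ring
  simp only [this]
  exact tendsto_const_nhds.sub (hsum z z').hasSum.tendsto_sum_nat

theorem IsModel.sum_abs_slope_le [Fintype X] (hm : IsModel P σ2 f v E U)
    (h : IsAdapted f v E U x y) (k : ℕ) (ω : Ω) (x' : X) :
    ∑ z, |slope σ2 (state P σ2 f x y k ω) x' z| ≤ ∑ z, (1 + (priorOf P f).2 z z) := by
  refine Finset.sum_le_sum fun z _ => ?_
  have h1 := (hm.slope_sq_le h k ω x' z).trans (hm.state_cov_self_le h k ω z)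
  nlinarith [sq_abs (slope σ2 (state P σ2 f x y k ω) x' z),
    sq_nonneg (|slope σ2 (state P σ2 f x y k ω) x' z| - 1)]

end Path

/-! ### The mean knowledge gradient tends to zero along the policy -/

section Policy

variable {X Ω S : Type*} [Fintype X] [Nonempty X] [mΩ : MeasurableSpace Ω] [MeasurableSpace S]
  {P : Measure Ω} {σ2 : X → ℝ≥0} {f : X → Ω → ℝ} {v : ℕ → X → Ω → ℝ}
  {E : ℕ → ℕ → Ω → ℝ} {U : Ω → S} {x : ℕ → Ω → X} {y : ℕ → Ω → ℝ} {m₀ : ℕ} {N : ℕ → Ω → ℕ}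

/-- Admitting the base samples of all periods, even future ones, is harmless here: they carry no
information about the process and the noise. -/
theorem IsOKGRun.isAdapted (hr : IsOKGRun P σ2 f v E U m₀ N x y) : IsAdapted f v E U x y := by
  refine ⟨hr.observation, fun k => ?_⟩
  rcases lt_or_ge k m₀ with hk | hk
  · exact (hr.initial k hk).mono (sup_le (le_sup_left.trans le_sup_left) le_sup_right) le_rfl
  · obtain ⟨n, rfl⟩ := Nat.exists_eq_add_of_le hk
    refine (hr.nonanticipating n).mono (sup_le (sup_le (sup_le ?_ le_sup_right) ?_) ?_) le_rfl
    · exact le_sup_left.trans le_sup_left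
    · exact iSup_le fun j => (le_iSup (sampleSigma E) j).trans (le_sup_right.trans le_sup_left)
    · exact (le_iSup (sampleSigma E) n).trans (le_sup_right.trans le_sup_left)

theorem IsOKGRun.pastSigma_le (hr : IsOKGRun P σ2 f v E U m₀ N x y) (n : ℕ) :
    pastSigma U E x y m₀ n ≤ MeasurableSpace.comap
      (fun ω => ((((fun (j : Fin n) i => E j i ω), fun k x => v k x ω), fun x => f x ω), U ω))
      inferInstance := by
  have hinit := hr.initial
  have hnext := hr.nonanticipating
  have hobs := hr.observation
  set W : Ω → (((Fin n → ℕ → ℝ) × (ℕ → X → ℝ)) × (X → ℝ)) × S := fun ω =>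
    ((((fun (j : Fin n) i => E j i ω), fun k x => v k x ω), fun x => f x ω), U ω)
  set M := MeasurableSpace.comap W inferInstance
  have hU : MeasurableSpace.comap U inferInstance ≤ M :=
    measurable_iff_comap_le.1 (measurable_comap_comp W measurable_snd)
  have hf : ∀ z, Measurable[M] (f z) := fun z =>
    measurable_comap_comp W (g := fun q => q.1.2 z) (by fun_prop)
  have hv : ∀ k z, Measurable[M] (v k z) := fun k z =>
    measurable_comap_comp W (g := fun q => q.1.1.2 k z) (by fun_prop)
  have hE : ∀ j < n, sampleSigma E j ≤ M := fun j hj => iSup_le fun i =>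
    measurable_iff_comap_le.1
      (measurable_comap_comp W (g := fun q => q.1.1.1 ⟨j, hj⟩ i) (by fun_prop))
  have hdata : ∀ k ≤ m₀ + n, dataSigma x y k ≤ M := by
    intro k
    induction k with
    | zero => exact fun _ => dataSigma_zero_le
    | succ k ih =>
      intro hk
      have ih := ih (Nat.le_of_succ_le hk)
      have hx : Measurable[M, ⊤] (x k) := by
        rcases lt_or_ge k m₀ with hkm | hkm
        · exact (hinit k hkm).mono (sup_le hU ih) le_rfl
        · obtain ⟨i, rfl⟩ := Nat.exists_eq_add_of_le hkm
          have hi : i < n := by omega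
          exact (hnext i).mono (sup_le (sup_le (sup_le hU ih)
            (iSup_le fun j => hE j (j.2.trans hi))) (hE i hi)) le_rfl
      refine dataSigma_succ_le ih hx ?_
      have : y k = fun ω => f (x k ω) ω + v k (x k ω) ω := funext (hobs k)
      rw [this]
      exact measurable_apply_add_apply hx hf (hv k)
  exact sup_le (sup_le hU (hdata _ le_rfl)) (iSup_le fun j => hE j j.2)

variable [IsProbabilityMeasure P]

theorem IsModel.indepFun_state_samples (hm : IsModel P σ2 f v E U)
    (hr : IsOKGRun P σ2 f v E U m₀ N x y) (n : ℕ) :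
    IndepFun (fun ω => (state P σ2 f x y (m₀ + n) ω, N n ω)) (fun ω i => E n i ω) P := by
  rw [IndepFun_iff_Indep]
  refine indep_of_indep_of_le_left
    ((IndepFun_iff_Indep _ _ _).1 (hm.indepFun_samples_period n).symm)
    (le_trans ?_ (hr.pastSigma_le n))
  rw [← measurable_iff_comap_le]
  refine Measurable.prodMk ?_ (hr.sampleSize n)
  exact (OKG.measurable_state P σ2 f x y (m₀ + n)).mono (le_sup_right.trans le_sup_left) le_rfl

theorem KGhat_eq_average (p : GPState X) {n : ℕ} (hn : 1 ≤ n) (e : ℕ → ℝ) (x' : X) :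
    KGhat σ2 p (fun i : Fin n => e i) x' =
      (1 / (n : ℝ)) * ∑ i ∈ Finset.range n, (nextMax σ2 p x' (e i) - maxVal p.1) := by
  have h0 : (n : ℝ) ≠ 0 := by positivity
  rw [KGhat, Finset.sum_sub_distrib, Finset.sum_const, Finset.card_range, nsmul_eq_mul,
    Finset.sum_range]
  field_simp

/-- Lipschitz bound, then Young's inequality with weight `t`, then Cauchy–Schwarz for the sum of
slopes. Young's inequality is essential: the measured point depends on the base samples, and this
separates its slopes from them additively. -/
theorem KGhat_le (p : GPState X) {n : ℕ} (hn : 1 ≤ n) (e : ℕ → ℝ) (x' : X) {t : ℝ} (ht : 0 < t) :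
    KGhat σ2 p (fun i : Fin n => e i) x' ≤
      (Fintype.card X * (∑ z, slope σ2 p x' z ^ 2) / t +
        t * ((1 / (n : ℝ)) * ∑ i ∈ Finset.range n, e i ^ 2)) / 2 := by
  have h0 : (n : ℝ) ≠ 0 := by positivity
  have hn0 : (0 : ℝ) ≤ 1 / (n : ℝ) := by positivity
  set c : ℝ := Fintype.card X * ∑ z, slope σ2 p x' z ^ 2 with hc
  have hS : (∑ z, |slope σ2 p x' z|) ^ 2 ≤ c := by
    have := sq_sum_le_card_mul_sum_sq (s := Finset.univ) (f := fun z => |slope σ2 p x' z|)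
    simpa [hc] using this
  have hterm : ∀ a, nextMax σ2 p x' a - maxVal p.1 ≤ (c / t + t * a ^ 2) / 2 := by
    intro a
    rw [nextMax_eq_lineMax]
    refine (le_abs_self _).trans ((abs_lineMax_sub_maxVal_le _ _ _).trans ?_)
    set s := ∑ z, |slope σ2 p x' z|
    have h1 : s ^ 2 / t ≤ c / t := div_le_div_of_nonneg_right hS ht.le
    have h2 : 0 ≤ (s - t * |a|) ^ 2 / t := by positivity
    have h3 : (s - t * |a|) ^ 2 / t = s ^ 2 / t - 2 * (s * |a|) + t * a ^ 2 := by
      rw [← sq_abs a]; field_simp; ring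
    linarith
  rw [KGhat_eq_average p hn e x']
  calc _ ≤ (1 / (n : ℝ)) * ∑ i ∈ Finset.range n, (c / t + t * e i ^ 2) / 2 :=
        mul_le_mul_of_nonneg_left (Finset.sum_le_sum fun i _ => hterm _) hn0
    _ = _ := by
        rw [← Finset.sum_div, Finset.sum_add_distrib, Finset.sum_const, Finset.card_range,
          nsmul_eq_mul, ← Finset.mul_sum]
        field_simp

theorem IsModel.abs_KG_le (hm : IsModel P σ2 f v E U) (h : IsAdapted f v E U x y) (k : ℕ) (ω : Ω)
    (x' : X) : |KG σ2 (state P σ2 f x y k ω) x'| ≤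
      (∑ z, (1 + (priorOf P f).2 z z)) * ∫ ε, |ε| ∂(gaussianReal 0 1) := by
  rw [KG_eq]
  exact (abs_meanMax_sub_maxVal_le _ _).trans (mul_le_mul_of_nonneg_right
    (hm.sum_abs_slope_le h k ω x') (integral_nonneg fun _ => abs_nonneg _))

theorem IsModel.integrable_KG (hm : IsModel P σ2 f v E U) (h : IsAdapted f v E U x y) (k : ℕ)
    (x' : X) : Integrable (fun ω => KG σ2 (state P σ2 f x y k ω) x') P :=
  (integrable_const _).mono' ((measurable_KG σ2 x').comp
    (hm.measurable_state h k)).aestronglyMeasurable (ae_of_all _ fun ω => hm.abs_KG_le h k ω x')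

omit [Nonempty X] in
theorem IsModel.integrable_state_cov_self (hm : IsModel P σ2 f v E U)
    (h : IsAdapted f v E U x y) (k : ℕ) (z : X) :
    Integrable (fun ω => (state P σ2 f x y k ω).2 z z) P := by
  have hmeas : Measurable fun ω => (state P σ2 f x y k ω).2 z z := by
    have := hm.measurable_state h k
    fun_prop
  refine (integrable_const ((priorOf P f).2 z z)).mono' hmeas.aestronglyMeasurable
    (ae_of_all _ fun ω => ?_)
  rw [Real.norm_eq_abs, abs_of_nonneg (hm.state_cov_self_nonneg h k ω z)]
  exact hm.state_cov_self_le h k ω z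

/-- The mean knowledge gradient is controlled by the mean decrease of the posterior variance. -/
theorem IsModel.integral_KG_le (hm : IsModel P σ2 f v E U)
    (hr : IsOKGRun P σ2 f v E U m₀ N x y) (n : ℕ) (x' : X) {t : ℝ} (ht : 0 < t) :
    ∫ ω, KG σ2 (state P σ2 f x y (m₀ + n) ω) x' ∂P ≤
      (Fintype.card X * (∑ z, ((∫ ω, (state P σ2 f x y (m₀ + n) ω).2 z z ∂P) -
        ∫ ω, (state P σ2 f x y (m₀ + n + 1) ω).2 z z ∂P)) / t + t) / 2 := by
  have h := hr.isAdapted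
  have hN : Measurable (N n) := (hr.sampleSize n).mono ((hr.pastSigma_le n).trans
    (((((measurable_pi_lambda _ fun j : Fin n => measurable_pi_lambda _ fun i =>
      hm.measurable_E j i).prodMk hm.measurable_v_pi).prodMk
      hm.measurable_f_pi).prodMk hm.measurable_U).comap_le)) le_rfl
  have hE : Measurable fun ω i => E n i ω := measurable_pi_lambda _ fun i => hm.measurable_E n i
  have hst := hm.measurable_state h (m₀ + n)
  have hind := hm.indepFun_state_samples hr n
  obtain ⟨i1, e1⟩ := integral_average hst hN hE hind (hm.law_E n) (hr.sampleSize_pos n)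
    (g := fun r => nextMax σ2 r.1 x' r.2 - maxVal r.1.1)
    ((measurable_nextMax σ2 x').sub (measurable_maxVal.comp (by fun_prop)))
    (fun p => (integrable_nextMax σ2 p x').sub (integrable_const (maxVal p.1)))
    (C := (∑ z, (1 + (priorOf P f).2 z z)) * ∫ ε, |ε| ∂(gaussianReal 0 1)) (fun ω => by
      rw [← integral_const_mul]
      refine integral_mono
        ((integrable_nextMax σ2 (state P σ2 f x y (m₀ + n) ω) x').sub (integrable_const
          (maxVal (state P σ2 f x y (m₀ + n) ω).1))).abs
        (integrable_id_gaussianReal.abs.const_mul _) fun a => ?_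
      simp only [nextMax_eq_lineMax]
      exact (abs_lineMax_sub_maxVal_le _ _ _).trans (mul_le_mul_of_nonneg_right
        (hm.sum_abs_slope_le h _ ω x') (abs_nonneg _)))
  have hsq : Integrable (fun a : ℝ => a ^ 2) (gaussianReal 0 1) :=
    (memLp_id_gaussianReal 2).integrable_sq
  have hsq1 : ∫ a : ℝ, a ^ 2 ∂(gaussianReal 0 1) = 1 := by
    have := variance_id_gaussianReal (μ := 0) (v := 1)
    rw [variance_of_integral_eq_zero aemeasurable_id (by simp)] at this
    simpa using this
  -- The same averaging lemma, now for the mean square of the base samples, which has expectation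
  -- one.
  obtain ⟨i2, e2⟩ := integral_average hst hN hE hind (hm.law_E n) (hr.sampleSize_pos n)
    (g := fun r => r.2 ^ 2) (by fun_prop) (fun _ => hsq) (C := 1) (fun ω => by
      simp only [abs_sq]; rw [hsq1])
  simp only [hsq1, integral_const, probReal_univ, smul_eq_mul, mul_one] at e2
  have hdiff : Integrable (fun ω => ∑ z, ((state P σ2 f x y (m₀ + n) ω).2 z z -
      (state P σ2 f x y (m₀ + n + 1) ω).2 z z)) P :=
    integrable_finsetSum _ fun z _ => (hm.integrable_state_cov_self h _ z).sub
      (hm.integrable_state_cov_self h _ z)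
  have hdiffval : ∫ ω, ∑ z, ((state P σ2 f x y (m₀ + n) ω).2 z z -
      (state P σ2 f x y (m₀ + n + 1) ω).2 z z) ∂P =
      ∑ z, ((∫ ω, (state P σ2 f x y (m₀ + n) ω).2 z z ∂P) -
        ∫ ω, (state P σ2 f x y (m₀ + n + 1) ω).2 z z ∂P) := by
    rw [integral_finsetSum]
    · exact Finset.sum_congr rfl fun z _ => integral_sub (hm.integrable_state_cov_self h _ z)
        (hm.integrable_state_cov_self h _ z)
    · exact fun z _ => (hm.integrable_state_cov_self h _ z).sub
        (hm.integrable_state_cov_self h _ z)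
  have i3 : Integrable (fun ω => (Fintype.card X *
      (∑ z, ((state P σ2 f x y (m₀ + n) ω).2 z z -
        (state P σ2 f x y (m₀ + n + 1) ω).2 z z)) / t +
        t * ((1 / (N n ω : ℝ)) * ∑ i ∈ Finset.range (N n ω), E n i ω ^ 2)) / 2) P :=
    (((hdiff.const_mul _).div_const _).add (i2.const_mul _)).div_const _
  calc ∫ ω, KG σ2 (state P σ2 f x y (m₀ + n) ω) x' ∂P
      = ∫ ω, (1 / (N n ω : ℝ)) * ∑ i ∈ Finset.range (N n ω),
          (nextMax σ2 (state P σ2 f x y (m₀ + n) ω) x' (E n i ω) -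
            maxVal (state P σ2 f x y (m₀ + n) ω).1) ∂P := by
        rw [e1]
        congr 1
        ext ω
        have := integral_sub (integrable_nextMax σ2 (state P σ2 f x y (m₀ + n) ω) x')
          (integrable_const (μ := gaussianReal 0 1) (maxVal (state P σ2 f x y (m₀ + n) ω).1))
        rw [this]
        simp [KG]
    _ ≤ ∫ ω, (Fintype.card X * (∑ z, ((state P σ2 f x y (m₀ + n) ω).2 z z -
        (state P σ2 f x y (m₀ + n + 1) ω).2 z z)) / t +
        t * ((1 / (N n ω : ℝ)) * ∑ i ∈ Finset.range (N n ω), E n i ω ^ 2)) / 2 ∂P := by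
        refine integral_mono_ae i1 i3 ?_
        filter_upwards [hr.maximizer n] with ω hω
        have h1 := hω x'
        have h2 := KGhat_le (σ2 := σ2) (state P σ2 f x y (m₀ + n) ω) (hr.sampleSize_pos n ω)
          (fun i => E n i ω) (x (m₀ + n) ω) ht
        have h3 := KGhat_eq_average (σ2 := σ2) (state P σ2 f x y (m₀ + n) ω)
          (hr.sampleSize_pos n ω) (fun i => E n i ω) x'
        have h4 : ∀ z, slope σ2 (state P σ2 f x y (m₀ + n) ω) (x (m₀ + n) ω) z ^ 2 =
            (state P σ2 f x y (m₀ + n) ω).2 z z - (state P σ2 f x y (m₀ + n + 1) ω).2 z z := by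
          intro z
          rw [hm.state_cov_succ h]
          ring
        simp only [h4] at h2
        rw [← h3]
        exact h1.trans h2
    _ = _ := by
        rw [integral_div, integral_add ((hdiff.const_mul _).div_const _) (i2.const_mul _),
          integral_const_mul, e2, integral_div, integral_const_mul, hdiffval, mul_one]

theorem IsModel.tendsto_integral_KG (hm : IsModel P σ2 f v E U)
    (hr : IsOKGRun P σ2 f v E U m₀ N x y) (x' : X) :
    Tendsto (fun n => ∫ ω, KG σ2 (state P σ2 f x y (m₀ + n) ω) x' ∂P) atTop (𝓝 0) := by
  have h := hr.isAdapted
  set V : X → ℕ → ℝ := fun z k => ∫ ω, (state P σ2 f x y k ω).2 z z ∂P with hV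
  have hVanti : ∀ z, Antitone (V z) := fun z => antitone_nat_of_succ_le fun k => by
    refine integral_mono (hm.integrable_state_cov_self h _ z) (hm.integrable_state_cov_self h _ z)
      fun ω => ?_
    simp only [hm.state_cov_succ h]
    nlinarith [mul_self_nonneg (slope σ2 (state P σ2 f x y k ω) (x k ω) z)]
  have hVdiff : ∀ z, Tendsto (fun n => V z (m₀ + n) - V z (m₀ + n + 1)) atTop (𝓝 0) := by
    intro z
    have hlim := tendsto_atTop_ciInf (hVanti z) ⟨0, by
      rintro _ ⟨k, rfl⟩
      exact integral_nonneg fun ω => hm.state_cov_self_nonneg h k ω z⟩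
    have h1 : Tendsto (fun n => m₀ + n) atTop atTop := by
      simpa only [add_comm] using tendsto_add_atTop_nat m₀
    have h2 : Tendsto (fun n => m₀ + n + 1) atTop atTop := (tendsto_add_atTop_nat 1).comp h1
    simpa using (hlim.comp h1).sub (hlim.comp h2)
  rw [Metric.tendsto_atTop]
  intro ε hε
  -- With the Young weight fixed at `ε`, the vanishing variance drops leave only `ε / 2`.
  have hsmall : Tendsto (fun n => (Fintype.card X *
      (∑ z, (V z (m₀ + n) - V z (m₀ + n + 1))) / ε + ε) / 2) atTop (𝓝 (ε / 2)) := by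
    have : Tendsto (fun n => ∑ z, (V z (m₀ + n) - V z (m₀ + n + 1))) atTop (𝓝 0) := by
      simpa using tendsto_finsetSum Finset.univ fun z _ => hVdiff z
    simpa using (((this.const_mul (Fintype.card X : ℝ)).div_const ε).add_const ε).div_const 2
  obtain ⟨n₀, hn₀⟩ := eventually_atTop.1 (hsmall.eventually_lt_const (half_lt_self hε))
  refine ⟨n₀, fun n hn => ?_⟩
  rw [dist_zero_right, Real.norm_eq_abs,
    abs_of_nonneg (integral_nonneg fun ω => KG_nonneg σ2 _ x')]
  exact (hm.integral_KG_le hr n x' hε).trans_lt (hn₀ n hn)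

end Policy

/-! ### Identification of limits -/

section Limits

/-- Fatou's lemma makes the lower limit vanish almost surely. Convergence in mean alone gives no
pathwise limit, so the conclusion is about limits that are known to exist. -/
theorem ae_eq_zero_of_tendsto_of_tendsto_integral {Ω : Type*} {mΩ : MeasurableSpace Ω}
    {P : Measure Ω} {u : ℕ → Ω → ℝ} (hm : ∀ n, Measurable (u n)) (h0 : ∀ n ω, 0 ≤ u n ω)
    (hi : ∀ n, Integrable (u n) P) (hlim : Tendsto (fun n => ∫ ω, u n ω ∂P) atTop (𝓝 0)) :
    ∀ᵐ ω ∂P, ∀ c, Tendsto (fun n => u n ω) atTop (𝓝 c) → c = 0 := by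
  have h1 : ∫⁻ ω, liminf (fun n => ENNReal.ofReal (u n ω)) atTop ∂P = 0 := by
    refine le_antisymm ((lintegral_liminf_le fun n => (hm n).ennreal_ofReal).trans ?_) zero_le
    have : Tendsto (fun n => ∫⁻ ω, ENNReal.ofReal (u n ω) ∂P) atTop (𝓝 0) := by
      simp only [← ofReal_integral_eq_lintegral_ofReal (hi _) (ae_of_all _ (h0 _))]
      simpa using ENNReal.tendsto_ofReal hlim
    exact this.liminf_eq.le
  rw [lintegral_eq_zero_iff (Measurable.liminf fun n => (hm n).ennreal_ofReal)] at h1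
  filter_upwards [h1] with ω hω c hc
  have h2 := (ENNReal.tendsto_ofReal hc).liminf_eq
  rw [h2, Pi.zero_apply, ENNReal.ofReal_eq_zero] at hω
  exact le_antisymm hω (ge_of_tendsto' hc fun n => h0 n ω)

variable {X : Type*} [Fintype X] [Nonempty X]

theorem tendsto_maxVal {m : ℕ → X → ℝ} {m' : X → ℝ}
    (hm : ∀ z, Tendsto (fun n => m n z) atTop (𝓝 (m' z))) :
    Tendsto (fun n => maxVal (m n)) atTop (𝓝 (maxVal m')) := by
  have h := tendsto_meanMax hm (s := fun _ _ => 0) (s' := fun _ => 0) fun _ => tendsto_const_nhds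
  simpa [meanMax, lineMax] using h

/-- Maximizers of functions which converge up to an additive constant are asymptotically
optimal. -/
theorem tendsto_apply_argmax {F m' : X → ℝ} {m : ℕ → X → ℝ} {χ : ℕ → X}
    (hm : ∀ z, Tendsto (fun n => m n z) atTop (𝓝 (m' z)))
    (hF : ∀ z z', F z - F z' = m' z - m' z') (hχ : ∀ n, IsArgmax (m n) (χ n)) :
    Tendsto (fun n => F (χ n)) atTop (𝓝 (maxVal F)) := by
  obtain ⟨y, hy⟩ := exists_eq_maxVal F
  have hd : Tendsto (fun n => ∑ z, |m n z - m' z|) atTop (𝓝 0) := by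
    simpa using tendsto_finsetSum Finset.univ fun z _ => ((hm z).sub_const (m' z)).abs
  have hlow : Tendsto (fun n => maxVal F - 2 * ∑ z, |m n z - m' z|) atTop (𝓝 (maxVal F)) := by
    simpa using (hd.const_mul 2).const_sub (maxVal F)
  refine tendsto_of_tendsto_of_tendsto_of_le_of_le hlow tendsto_const_nhds (fun n => ?_)
    fun n => le_maxVal F _
  have h1 := abs_le_sum_abs (fun z => m n z - m' z) y
  have h2 := abs_le_sum_abs (fun z => m n z - m' z) (χ n)
  have h3 := hF y (χ n)
  have h4 := hχ n y
  simp only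
  rw [← hy]
  linarith [neg_abs_le (m n y - m' y), le_abs_self (m n (χ n) - m' (χ n))]

/-- If the knowledge gradient vanishes in the limit, then the limiting covariances with the values
of the process at `x'` are all equal. -/
theorem cov_eq_of_tendsto_KG {σ2 : X → ℝ≥0} {p : ℕ → GPState X} {m' : X → ℝ} {L : X → X → ℝ}
    (hm : ∀ z, Tendsto (fun n => (p n).1 z) atTop (𝓝 (m' z)))
    (hL : ∀ z z', Tendsto (fun n => (p n).2 z z') atTop (𝓝 (L z z')))
    (hnn : ∀ n z, 0 ≤ (p n).2 z z)
    (hsq : ∀ n z z', (p n).2 z z' ^ 2 ≤ (p n).2 z z * (p n).2 z' z') {x' : X}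
    (hKG : ∀ c, Tendsto (fun n => KG σ2 (p n) x') atTop (𝓝 c) → c = 0) (z z' : X) :
    L z x' = L z' x' := by
  have hLnn : 0 ≤ L x' x' := ge_of_tendsto' (hL x' x') fun n => hnn n x'
  have hσ : (0 : ℝ) ≤ σ2 x' := (σ2 x').coe_nonneg
  -- The slope need not be continuous where the limiting predictive variance is zero; there
  -- Cauchy–Schwarz makes all limiting covariances with `x'` zero.
  rcases eq_or_ne (L x' x' + σ2 x') 0 with h0 | h0
  · have hx : L x' x' = 0 := by linarith
    have hz : ∀ z, L z x' = 0 := fun z => by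
      have := le_of_tendsto_of_tendsto' ((hL z x').pow 2) ((hL z z).mul (hL x' x'))
        fun n => hsq n z x'
      rw [hx, mul_zero] at this
      exact pow_eq_zero_iff two_ne_zero |>.1 (le_antisymm this (sq_nonneg _))
    rw [hz, hz]
  · have hs := (hL x' x').add_const (σ2 x' : ℝ)
    have hslope : ∀ z, Tendsto (fun n => slope σ2 (p n) x' z) atTop
        (𝓝 (slope σ2 (m', L) x' z)) := fun z =>
      ((hL z x').div hs h0).mul hs.sqrt
    have hlim : Tendsto (fun n => KG σ2 (p n) x') atTop (𝓝 (KG σ2 (m', L) x')) := by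
      simp only [KG_eq]
      exact (tendsto_meanMax hm hslope).sub (tendsto_maxVal hm)
    have hK := hKG _ hlim
    rw [KG_eq, sub_eq_zero] at hK
    have heq := slope_eq_of_meanMax_eq hK z z'
    simp only [slope] at heq
    have hr : Real.sqrt (L x' x' + σ2 x') ≠ 0 :=
      (Real.sqrt_pos.2 (lt_of_le_of_ne (add_nonneg hLnn hσ) (Ne.symm h0))).ne'
    have := mul_right_cancel₀ hr heq
    exact (div_left_inj' h0).1 this

end Limits

/-! ### Consistency of the policy -/

section Consistency

variable {X Ω S : Type*} [Fintype X] [Nonempty X] [mΩ : MeasurableSpace Ω] [MeasurableSpace S]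
  {P : Measure Ω} [IsProbabilityMeasure P] {σ2 : X → ℝ≥0} {f : X → Ω → ℝ} {v : ℕ → X → Ω → ℝ}
  {E : ℕ → ℕ → Ω → ℝ} {U : Ω → S} {x : ℕ → Ω → X} {y : ℕ → Ω → ℝ} {m₀ : ℕ} {N : ℕ → Ω → ℕ}

/-- If the posterior variance of the difference of two values of the process vanishes in the
limit, then this difference is the limit of the differences of the posterior means. -/
theorem IsModel.ae_sub_eq_of_tendsto (hm : IsModel P σ2 f v E U) (h : IsAdapted f v E U x y)
    {k : ℕ → ℕ} (z z' : X) {M : X → Ω → ℝ}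
    (hM : ∀ᵐ ω ∂P, ∀ z, Tendsto (fun n => (state P σ2 f x y (k n) ω).1 z) atTop (𝓝 (M z ω)))
    (hV : ∀ᵐ ω ∂P, Tendsto (fun n => (state P σ2 f x y (k n) ω).2 z z -
      (state P σ2 f x y (k n) ω).2 z z' - (state P σ2 f x y (k n) ω).2 z' z +
      (state P σ2 f x y (k n) ω).2 z' z') atTop (𝓝 0)) :
    ∀ᵐ ω ∂P, f z ω - f z' ω = M z ω - M z' ω := by
  set D : ℕ → Ω → ℝ := fun n ω => ((f z ω - (state P σ2 f x y (k n) ω).1 z) -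
        (f z' ω - (state P σ2 f x y (k n) ω).1 z')) ^ 2 with hD
  set V : ℕ → Ω → ℝ := fun n ω => (state P σ2 f x y (k n) ω).2 z z -
      (state P σ2 f x y (k n) ω).2 z z' - (state P σ2 f x y (k n) ω).2 z' z +
      (state P σ2 f x y (k n) ω).2 z' z' with hVdef
  have hfz := hm.measurable_f z
  have hfz' := hm.measurable_f z'
  have hDm : ∀ n, Measurable (D n) := fun n => by
    have := hm.measurable_state h (k n)
    fun_prop
  have hVm : ∀ n, Measurable (V n) := fun n => by
    have := hm.measurable_state h (k n)
    fun_prop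
  have hVb : ∀ n ω, ‖V n ω‖ ≤ 2 * ((priorOf P f).2 z z + (priorOf P f).2 z' z') := by
    intro n ω
    have h1 := hm.state_cov_self_le h (k n) ω z
    have h2 := hm.state_cov_self_le h (k n) ω z'
    have h3 := hm.state_cov_sq_le h (k n) ω z z'
    have h4 := hm.state_cov_comm h (k n) ω z z'
    have h5 := hm.state_cov_self_nonneg h (k n) ω z
    have h6 := hm.state_cov_self_nonneg h (k n) ω z'
    simp only [hVdef, ← h4]
    set a := (state P σ2 f x y (k n) ω).2 z z
    set b := (state P σ2 f x y (k n) ω).2 z' z'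
    set c := (state P σ2 f x y (k n) ω).2 z z'
    have hc : |c| ≤ (a + b) / 2 :=
      abs_le_of_sq_le_sq (by nlinarith [sq_nonneg (a - b)]) (by linarith)
    rw [Real.norm_eq_abs, abs_le]
    constructor <;> linarith [(abs_le.1 hc).1, (abs_le.1 hc).2]
  have hVi : ∀ n, Integrable (V n) P := fun n =>
    (integrable_const _).mono' (hVm n).aestronglyMeasurable (ae_of_all _ (hVb n))
  have hDi : ∀ n, Integrable (D n) P ∧ ∫ ω, D n ω ∂P = ∫ ω, V n ω ∂P := by
    intro n
    obtain ⟨h1, h2⟩ := hm.integral_sq_sub_state h (k n) z z'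
    have hi : Integrable (D n) P := by
      refine (h1.add (hVi n)).congr (ae_of_all _ fun ω => ?_)
      simp only [Pi.add_apply, hD, hVdef]
      ring
    refine ⟨hi, ?_⟩
    have h3 : ∫ ω, (D n ω - V n ω) ∂P = 0 := h2
    rw [integral_sub hi (hVi n)] at h3
    linarith
  -- The squared error has the same mean as the posterior variance of the difference, which is
  -- bounded by a constant and tends to zero almost surely.
  have hDlim : Tendsto (fun n => ∫ ω, D n ω ∂P) atTop (𝓝 0) := by
    simp only [fun n => (hDi n).2]
    have := tendsto_integral_of_dominated_convergence _
      (fun n => (hVm n).aestronglyMeasurable) (integrable_const _)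
      (fun n => ae_of_all P (hVb n)) hV
    simpa using this
  filter_upwards [hM, ae_eq_zero_of_tendsto_of_tendsto_integral hDm (fun n ω => sq_nonneg _)
    (fun n => (hDi n).1) hDlim] with ω hω h0
  have := h0 _ ((((hω z).const_sub (f z ω)).sub ((hω z').const_sub (f z' ω))).pow 2)
  have := pow_eq_zero_iff two_ne_zero |>.1 this
  linarith

theorem IsModel.ae_tendsto_argmax (hm : IsModel P σ2 f v E U)
    (hr : IsOKGRun P σ2 f v E U m₀ N x y) {χ : ℕ → Ω → X}
    (hχ : ∀ n, ∀ᵐ ω ∂P, IsArgmax (fun z => (P[f z | dataSigma x y (m₀ + n)]) ω) (χ n ω)) :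
    ∀ᵐ ω ∂P, Tendsto (fun n => f (χ n ω) ω) atTop (𝓝 (maxVal fun z => f z ω)) := by
  have h := hr.isAdapted
  let ℱ : Filtration ℕ mΩ :=
    { seq := fun n => dataSigma x y (m₀ + n)
      mono' := fun i j hij => dataSigma_mono x y (Nat.add_le_add_left hij m₀)
      le' := fun n => hm.dataSigma_le_of h (m₀ + n) }
  have hce : ∀ᵐ ω ∂P, ∀ n z, (P[f z | dataSigma x y (m₀ + n)]) ω =
      (state P σ2 f x y (m₀ + n) ω).1 z :=
    ae_all_iff.2 fun n => ae_all_iff.2 fun z => hm.condExp_eq h (m₀ + n) z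
  have hM : ∀ᵐ ω ∂P, ∀ z, Tendsto (fun n => (state P σ2 f x y (m₀ + n) ω).1 z) atTop
      (𝓝 ((P[f z | ⨆ n, ℱ n]) ω)) := by
    have : ∀ᵐ ω ∂P, ∀ z, Tendsto (fun n => (P[f z | ℱ n]) ω) atTop
        (𝓝 ((P[f z | ⨆ n, ℱ n]) ω)) := ae_all_iff.2 fun z => tendsto_ae_condExp (f z)
    filter_upwards [this, hce] with ω h1 h2 z
    exact (h1 z).congr fun n => h2 n z
  have hKG : ∀ᵐ ω ∂P, ∀ x' c,
      Tendsto (fun n => KG σ2 (state P σ2 f x y (m₀ + n) ω) x') atTop (𝓝 c) → c = 0 :=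
    ae_all_iff.2 fun x' => ae_eq_zero_of_tendsto_of_tendsto_integral
      (fun n => (measurable_KG σ2 x').comp (hm.measurable_state h _))
      (fun n ω => KG_nonneg σ2 _ x') (fun n => hm.integrable_KG h _ x')
      (hm.tendsto_integral_KG hr x')
  have hk : Tendsto (fun n => m₀ + n) atTop atTop := by
    simpa only [add_comm] using tendsto_add_atTop_nat m₀
  have hV : ∀ z z', ∀ᵐ ω ∂P, Tendsto (fun n => (state P σ2 f x y (m₀ + n) ω).2 z z -
      (state P σ2 f x y (m₀ + n) ω).2 z z' - (state P σ2 f x y (m₀ + n) ω).2 z' z +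
      (state P σ2 f x y (m₀ + n) ω).2 z' z') atTop (𝓝 0) := by
    intro z z'
    filter_upwards [hM, hKG] with ω h1 h2
    obtain ⟨L, hL⟩ := hm.exists_tendsto_state_cov h ω
    have hL' : ∀ z z', Tendsto (fun n => (state P σ2 f x y (m₀ + n) ω).2 z z') atTop
        (𝓝 (L z z')) := fun z z' => (hL z z').comp hk
    have heq : ∀ x', L z x' = L z' x' := fun x' =>
      cov_eq_of_tendsto_KG h1 hL' (fun n z => hm.state_cov_self_nonneg h _ ω z)
        (fun n z z' => hm.state_cov_sq_le h _ ω z z') (h2 x') z z'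
    -- By `heq` at `z` and at `z'`, the limit of the variance of the difference cancels to zero.
    have := (((hL' z z).sub (hL' z z')).sub (hL' z' z)).add (hL' z' z')
    rw [heq z, heq z'] at this
    simpa using this
  have hsub : ∀ᵐ ω ∂P, ∀ z z', f z ω - f z' ω =
      (P[f z | ⨆ n, ℱ n]) ω - (P[f z' | ⨆ n, ℱ n]) ω :=
    ae_all_iff.2 fun z => ae_all_iff.2 fun z' => hm.ae_sub_eq_of_tendsto h z z' hM (hV z z')
  filter_upwards [hM, hsub, hce, ae_all_iff.2 hχ] with ω h1 h2 h3 h4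
  refine tendsto_apply_argmax h1 h2 fun n z => ?_
  have := h4 n z
  simp only [h3 n] at this
  exact this

end Consistency

end OKG

/-! ### The theorem -/

theorem theorem5 {X Ω S : Type*} [Fintype X] [Nonempty X] [MeasurableSpace Ω]
    [MeasurableSpace S] (P : Measure Ω) [IsProbabilityMeasure P] (σ2 : X → ℝ≥0)
    (f : X → Ω → ℝ) (v : ℕ → X → Ω → ℝ) (E : ℕ → ℕ → Ω → ℝ) (U : Ω → S)
    (hmodel : OKG.IsModel P σ2 f v E U) :
    (∃ A K : OKG.GPState X → ℝ, Measurable A ∧ Measurable K ∧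
      ∀ D : List (X × ℝ),
        0 < A (OKG.posterior σ2 (OKG.priorOf P f) D) ∧
        0 < K (OKG.posterior σ2 (OKG.priorOf P f) D) ∧
        ∀ δ : ℝ, 0 < δ → ∀ N : ℕ, 1 ≤ N →
          (A (OKG.posterior σ2 (OKG.priorOf P f) D))⁻¹ *
            Real.log (K (OKG.posterior σ2 (OKG.priorOf P f) D) / δ) ≤ N →
          (Measure.pi (fun _ : Fin N => gaussianReal 0 1)).real
            {ε | ¬ ∀ z, OKG.IsArgmax (OKG.KGhat σ2 (OKG.posterior σ2 (OKG.priorOf P f) D) ε) z →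
                OKG.IsArgmax (OKG.KG σ2 (OKG.posterior σ2 (OKG.priorOf P f) D)) z} ≤ δ) ∧
    (∀ (m₀ : ℕ) (N : ℕ → Ω → ℕ) (x : ℕ → Ω → X) (y : ℕ → Ω → ℝ) (χ : ℕ → Ω → X),
      OKG.IsOKGRun P σ2 f v E U m₀ N x y →
      (∀ n, ∀ᵐ ω ∂P,
        OKG.IsArgmax (fun z => (P[f z | OKG.dataSigma x y (m₀ + n)]) ω) (χ n ω)) →
      ∀ A K : List (X × ℝ) → ℝ, (∀ D, 0 < A D) → (∀ D, 0 < K D) →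
      ∀ δ : ℝ, 0 < δ →
      (∀ n, ∀ᵐ ω ∂P,
        (A (OKG.dataList x y (m₀ + n) ω))⁻¹ *
          Real.log (K (OKG.dataList x y (m₀ + n) ω) / δ) ≤ N n ω) →
      ∀ᵐ ω ∂P, Tendsto (fun n => f (χ n ω) ω) atTop (𝓝 (OKG.maxVal (fun z => f z ω)))) := by
  -- The rate is the Chernoff exponent per sample, and the constant is the number of terms in the
  -- union bound.
  refine ⟨⟨OKG.rateKG σ2, fun _ => Fintype.card X, OKG.measurable_rateKG σ2, measurable_const,
    fun D => ⟨OKG.rateKG_pos σ2 _, (Nat.cast_pos (α := ℝ)).2 Fintype.card_pos, fun δ hδ N hN h =>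
      OKG.measureReal_argmax_not_subset_le_of_le σ2 _ hδ hN h⟩⟩, ?_⟩
  intro m₀ N x y χ hrun hχ _ _ _ _ _ _ _
  exact hmodel.ae_tendsto_argmax hrun hχ
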